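/- Let $\varepsilon>0$. Then for almost all positive integers $n$ with $8\nmid n$, the equation $$n=x_1^2+x_2^2+x_3^2+x_4^2$$ has a solution in positive integers $x_1,x_2,x_3,x_4$ with $$\max\{x_3,x_4\}\le (\log n)^{1/2}(\log\log n)^{3/2+\varepsilon}.$$ Here "almost all" means that the number of positive integers $n\le N$ with $8\nmid n$ for which there is no such solution is $o(N)$ as $N\to\infty$. -/

import Mathlib

open Filter Topology Asymptotics

/-- The number of positive integers `n ≤ N` with property `E`. -/
noncomputable def countUpTo (E : ℕ → Prop) (N : ℕ) : ℕ :=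
  {n : ℕ | 1 ≤ n ∧ n ≤ N ∧ E n}.ncard

/-- Almost all positive integers `n` with property `A` have property `P`: the number of
exceptions `n ≤ N` is `o(N)` as `N → ∞`. -/
def ForAlmostAllNatWith (A P : ℕ → Prop) : Prop :=
  (fun N : ℕ => (countUpTo (fun n => A n ∧ ¬ P n) N : ℝ)) =o[atTop] (fun N : ℕ => (N : ℝ))

/-! ### Counting integers in residue classes -/

/-! The proof is a second moment argument inside residue classes. Let V be squarefree, even and
divisible by every prime up to a large w. The values of (r₁ + 2Vt)² + (r₂ + 2Vu)² + (1 + 2Vj)² + (r₄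
+ 2Vk)² all lie in one class modulo 4V, and `exists_residues` supplies residues for any class not
divisible by 8. Take t in (LU, (L+m)U], u in [0, U) and j, k in [0, J), with L much larger than m
and m large. The box has mU²J² points, and the class has at most about 2VLmU² elements in the range
of the values. If the number of pairs of points with equal values is at most (1+η)J⁴U²m/(2VL), then
Cauchy–Schwarz (`card_sq_le_card_image_mul_card_collisions`) leaves only a proportion O(η) of the
class unrepresented.

To count collisions (`collisions_asymptotic`), fix d = t - t' > 0 and e = u' - u, and let H be the
shift contributed by the small variables. The equation is then linear in t' and u. With g = gcd(d,
e) it requires 2Vg to divide a constant containing H, and it has at most Sg/e + 1 solutions, where S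
= mU. Averaged over the small variables, the divisibility has frequency at most about 1/(2Vg) for g
≤ w, because j + Vj² is injective modulo any number whose primes all divide V. The factor g cancels,
and summing S/e over the admissible (d, e) gives the main term. For g > w the weaker frequency
d(g)/(2V√g), with d(g) the number of divisors, suffices: pairs with gcd g carry weight O(1/g), and Σ
d(g)/g^{3/2} has a small tail. No g exceeding every |H| can occur unless H = 0.

The case H = 0 costs about J²(log J)² · U² log U, which is negligible against J⁴U² once J² dominates
(log J)² log U. This is what fixes the size of the small variables. Finally `countUpTo_isLittleO`
chains windows (a²U², b²U²] down to a bounded initial segment. -/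

theorem card_le_of_dvd_sub {s : Finset ℤ} {a : ℤ} {S q : ℕ} (hq : 0 < q)
    (hs : ∀ x ∈ s, a < x ∧ x ≤ a + S) (h : ∀ x ∈ s, ∀ y ∈ s, (q : ℤ) ∣ x - y) :
    (s.card : ℝ) ≤ S / q + 1 := by
  have hq' : (0 : ℤ) < q := by exact_mod_cast hq
  have h1 : s.card ≤ (Finset.Icc (0 : ℤ) ((S : ℤ) / q)).card := by
    refine Finset.card_le_card_of_injOn (fun x => (x - a - 1) / q) ?_ ?_
    · intro x hx
      obtain ⟨h1, h2⟩ := hs x hx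
      simp only [Finset.coe_Icc, Set.mem_Icc]
      exact ⟨Int.ediv_nonneg (by omega) hq'.le, Int.ediv_le_ediv hq' (by omega)⟩
    · intro x hx y hy hxy
      simp only at hxy
      have hd : (q : ℤ) ∣ (x - a - 1) - (y - a - 1) := by
        have := h x hx y hy
        rwa [show (x - a - 1) - (y - a - 1) = x - y by ring]
      have hmod : (x - a - 1) % q = (y - a - 1) % q := (Int.modEq_iff_dvd.mpr hd).symm
      have e1 := Int.emod_add_mul_ediv (x - a - 1) q
      have e2 := Int.emod_add_mul_ediv (y - a - 1) q
      rw [hmod, hxy] at e1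
      omega
  have h2 : (Finset.Icc (0 : ℤ) ((S : ℤ) / q)).card = S / q + 1 := by
    rw [Int.card_Icc]
    rw [← Int.natCast_div, sub_zero, ← Nat.cast_succ, Int.toNat_natCast]
  rw [h2] at h1
  calc (s.card : ℝ) ≤ ((S / q + 1 : ℕ) : ℝ) := by exact_mod_cast h1
    _ = ((S / q : ℕ) : ℝ) + 1 := by push_cast; ring
    _ ≤ S / q + 1 := by gcongr; exact Nat.cast_div_le

theorem dvd_of_line {W c : ℤ} {d e : ℕ} {t u : ℤ} (h : W * d * t - W * e * u = c) :
    W * (Nat.gcd d e : ℤ) ∣ c := by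
  have h1 : (Nat.gcd d e : ℤ) ∣ d := by exact_mod_cast Nat.gcd_dvd_left d e
  have h2 : (Nat.gcd d e : ℤ) ∣ e := by exact_mod_cast Nat.gcd_dvd_right d e
  rw [← h, show W * d * t - W * e * u = W * (d * t - e * u) by ring]
  exact mul_dvd_mul_left _ (dvd_sub (h1.mul_right _) (h2.mul_right _))

/-- On the line the first coordinate determines the second, and first coordinates of two solutions
are congruent modulo e / gcd(d, e). -/
theorem card_line_le {W T c : ℤ} {S d e : ℕ} (hW : W ≠ 0) (he : 0 < e)
    {F : Finset (ℤ × ℤ)}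
    (hF : ∀ p ∈ F, T < p.1 ∧ p.1 ≤ T + S ∧ W * d * p.1 - W * e * p.2 = c) :
    (F.card : ℝ) ≤ S * (Nat.gcd d e) / e + 1 := by
  have hg : 0 < Nat.gcd d e := Nat.gcd_pos_of_pos_right _ he
  have heq : ∀ p ∈ F, ∀ p' ∈ F, (d : ℤ) * (p.1 - p'.1) = e * (p.2 - p'.2) := by
    intro p hp p' hp'
    have h1 := (hF p hp).2.2
    have h2 := (hF p' hp').2.2
    apply mul_left_cancel₀ hW
    linear_combination h1 - h2
  have hinj : Set.InjOn Prod.fst (F : Set (ℤ × ℤ)) := by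
    intro p hp p' hp' h
    have := heq p hp p' hp'
    rw [h, sub_self, mul_zero] at this
    have he' : (e : ℤ) ≠ 0 := by exact_mod_cast he.ne'
    have h2 : p.2 - p'.2 = 0 := by
      rcases mul_eq_zero.mp this.symm with h | h
      · exact absurd h he'
      · exact h
    exact Prod.ext h (by omega)
  rw [← Finset.card_image_of_injOn hinj]
  obtain ⟨q, hq⟩ : Nat.gcd d e ∣ e := Nat.gcd_dvd_right d e
  obtain ⟨d', hd'⟩ : Nat.gcd d e ∣ d := Nat.gcd_dvd_left d e
  have hq0 : 0 < q := Nat.pos_of_ne_zero (by rintro rfl; omega)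
  have hcop : Nat.Coprime q d' := by
    have := Nat.coprime_div_gcd_div_gcd hg
    rw [show d / Nat.gcd d e = d' from Nat.div_eq_of_eq_mul_right hg hd',
      show e / Nat.gcd d e = q from Nat.div_eq_of_eq_mul_right hg hq] at this
    exact this.symm
  have hmain := card_le_of_dvd_sub (s := F.image Prod.fst) (a := T) (S := S) hq0
    (by
      intro x hx
      obtain ⟨p, hp, rfl⟩ := Finset.mem_image.mp hx
      exact ⟨(hF p hp).1, (hF p hp).2.1⟩)
    (by
      intro x hx y hy
      obtain ⟨p, hp, rfl⟩ := Finset.mem_image.mp hx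
      obtain ⟨p', hp', rfl⟩ := Finset.mem_image.mp hy
      have h := heq p hp p' hp'
      have hgz : (Nat.gcd d e : ℤ) ≠ 0 := by exact_mod_cast hg.ne'
      have h1 : (d' : ℤ) * (p.1 - p'.1) = q * (p.2 - p'.2) := by
        apply mul_left_cancel₀ hgz
        have hdz : (d : ℤ) = Nat.gcd d e * d' := by exact_mod_cast hd'
        have hez : (e : ℤ) = Nat.gcd d e * q := by exact_mod_cast hq
        linear_combination h - (p.1 - p'.1) * hdz + (p.2 - p'.2) * hez
      have h2 : (q : ℤ) ∣ d' * (p.1 - p'.1) := ⟨_, h1⟩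
      exact (Nat.isCoprime_iff_coprime.mpr hcop).dvd_of_dvd_mul_left h2)
  refine hmain.trans (le_of_eq ?_)
  have hez : (e : ℝ) = Nat.gcd d e * q := by exact_mod_cast hq
  have hg' : (Nat.gcd d e : ℝ) ≠ 0 := by exact_mod_cast hg.ne'
  have hq' : (q : ℝ) ≠ 0 := by exact_mod_cast hq0.ne'
  congr 1
  rw [div_eq_div_iff hq' (by rw [hez]; positivity)]
  nth_rewrite 1 [hez]
  ring

/-! ### Quadratic congruences -/

/-- A common prime would divide V and hence 1. This is why the third variable gets residue 1. -/
theorem isCoprime_one_add_mul {V q : ℕ} (h : ∀ p : ℕ, p.Prime → p ∣ q → p ∣ V) (x : ℤ) :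
    IsCoprime (q : ℤ) (1 + V * x) := by
  rw [Int.isCoprime_iff_gcd_eq_one]
  by_contra hne
  obtain ⟨p, hp, hpd⟩ := Nat.exists_prime_and_dvd hne
  have h1 : (p : ℤ) ∣ (q : ℤ) :=
    (Int.natCast_dvd_natCast.mpr hpd).trans (Int.gcd_dvd_left ..)
  have h2 : (p : ℤ) ∣ 1 + V * x :=
    (Int.natCast_dvd_natCast.mpr hpd).trans (Int.gcd_dvd_right ..)
  have h3 : (p : ℤ) ∣ V := by exact_mod_cast h p hp (by exact_mod_cast h1)
  have h4 : (p : ℤ) ∣ 1 := (dvd_add_left (h3.mul_right x)).mp h2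
  exact hp.one_lt.ne' (by exact_mod_cast Int.eq_one_of_dvd_one (by positivity) h4)

/-- The difference of two values is (x - y)(1 + V(x + y)), whose second factor is a unit modulo q;
so all solutions lie in one class modulo q. -/
theorem card_quadratic_le_of_smooth {V q J : ℕ} (hq : 0 < q)
    (h : ∀ p : ℕ, p.Prime → p ∣ q → p ∣ V) (c : ℤ) :
    (((Finset.Ico (0 : ℤ) J).filter (fun j => (q : ℤ) ∣ j + V * j ^ 2 + c)).card : ℝ)
      ≤ J / q + 1 := by
  apply card_le_of_dvd_sub hq (a := -1)
  · intro x hx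
    simp only [Finset.mem_filter, Finset.mem_Ico] at hx
    omega
  · intro x hx y hy
    simp only [Finset.mem_filter, Finset.mem_Ico] at hx hy
    have h1 : (q : ℤ) ∣ (x - y) * (1 + V * (x + y)) := by
      have := dvd_sub hx.2 hy.2
      rwa [show x + V * x ^ 2 + c - (y + V * y ^ 2 + c) = (x - y) * (1 + V * (x + y)) by ring]
        at this
    exact (isCoprime_one_add_mul h _).dvd_of_dvd_mul_right h1

/-- Compare every solution j with a fixed one j₀ and sort by a = gcd(Wg, 1 + V(j + j₀)), a divisor
of g since it is coprime to W. With g = ab, solutions with the same a agree both modulo Wb and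
modulo Wa, and max(a, b) ≥ √g. -/
theorem card_quadratic_le {V W g J : ℕ} (hW : 0 < W) (hg : 0 < g)
    (h : ∀ p : ℕ, p.Prime → p ∣ W → p ∣ V) (c : ℤ) :
    (((Finset.Ico (0 : ℤ) J).filter (fun j => ((W * g : ℕ) : ℤ) ∣ j + V * j ^ 2 + c)).card : ℝ)
      ≤ g.divisors.card * (J / (W * √g) + 1) := by
  set s := (Finset.Ico (0 : ℤ) J).filter (fun j => ((W * g : ℕ) : ℤ) ∣ j + V * j ^ 2 + c) with hs
  have hg' : (0 : ℝ) < g := by exact_mod_cast hg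
  have hW' : (0 : ℝ) < W := by exact_mod_cast hW
  rcases s.eq_empty_or_nonempty with he | ⟨j₀, hj₀⟩
  · rw [he]; simp only [Finset.card_empty, Nat.cast_zero]; positivity
  have hz : ∀ x ∈ s, ∀ y ∈ s, ((W * g : ℕ) : ℤ) ∣ (x - y) * (1 + V * (x + y)) := by
    intro x hx y hy
    have := dvd_sub (Finset.mem_filter.mp hx).2 (Finset.mem_filter.mp hy).2
    rwa [show x + V * x ^ 2 + c - (y + V * y ^ 2 + c) = (x - y) * (1 + V * (x + y)) by ring]
      at this
  let φ : ℤ → ℕ := fun j => Int.gcd ((W * g : ℕ) : ℤ) (1 + V * (j + j₀))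
  have hcopW : ∀ j, Nat.Coprime (φ j) W := by
    intro j
    have h1 := isCoprime_one_add_mul h (j + j₀)
    have h2 : ((φ j : ℕ) : ℤ) ∣ 1 + V * (j + j₀) := Int.gcd_dvd_right ..
    have h3 := h1.of_isCoprime_of_dvd_right h2
    exact (Nat.isCoprime_iff_coprime.mp h3).symm
  have hφg : ∀ j, φ j ∣ g := by
    intro j
    have h1 : φ j ∣ W * g := by
      have : ((φ j : ℕ) : ℤ) ∣ ((W * g : ℕ) : ℤ) := Int.gcd_dvd_left ..
      exact_mod_cast this
    exact (hcopW j).dvd_of_dvd_mul_left h1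
  have hmaps : ∀ j ∈ s, φ j ∈ g.divisors := fun j _ => Nat.mem_divisors.mpr ⟨hφg j, hg.ne'⟩
  have hWa : ∀ j ∈ s, ∀ b : ℕ, φ j * b = g → ((W * b : ℕ) : ℤ) ∣ j - j₀ := by
    intro j hj b hb
    have hφ0 : 0 < φ j := Nat.pos_of_dvd_of_pos (hφg j) hg
    obtain ⟨z, hz'⟩ : ((φ j : ℕ) : ℤ) ∣ 1 + V * (j + j₀) := Int.gcd_dvd_right ..
    have h1 := hz j hj j₀ hj₀
    have h3 : IsCoprime ((W * b : ℕ) : ℤ) z := by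
      have := Int.isCoprime_iff_gcd_eq_one.mpr
        (Int.gcd_ediv_gcd_ediv_gcd (i := ((W * g : ℕ) : ℤ)) (j := 1 + V * (j + j₀)) hφ0)
      have e1 : ((W * g : ℕ) : ℤ) / (φ j : ℤ) = ((W * b : ℕ) : ℤ) := by
        apply Int.ediv_eq_of_eq_mul_right (by exact_mod_cast hφ0.ne')
        rw [← hb]; push_cast; ring
      have e2 : (1 + V * (j + j₀)) / (φ j : ℤ) = z :=
        Int.ediv_eq_of_eq_mul_right (by exact_mod_cast hφ0.ne') hz'
      change IsCoprime (((W * g : ℕ) : ℤ) / (φ j : ℤ)) ((1 + V * (j + j₀)) / (φ j : ℤ)) at this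
      rwa [e1, e2] at this
    have h4 : (φ j : ℤ) * ((W * b : ℕ) : ℤ) ∣ (φ j : ℤ) * ((j - j₀) * z) := by
      rw [show (φ j : ℤ) * ((j - j₀) * z) = (j - j₀) * (1 + V * (j + j₀)) by rw [hz']; ring]
      rw [show (φ j : ℤ) * ((W * b : ℕ) : ℤ) = ((W * g : ℕ) : ℤ) by rw [← hb]; push_cast; ring]
      exact h1
    have h5 := Int.dvd_of_mul_dvd_mul_left (by exact_mod_cast hφ0.ne') h4
    exact h3.dvd_of_dvd_mul_right h5
  have hfib : ∀ a ∈ g.divisors, ((s.filter (fun j => φ j = a)).card : ℝ) ≤ J / (W * √g) + 1 := by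
    intro a ha
    obtain ⟨b, hb⟩ := (Nat.mem_divisors.mp ha).1
    have ha0 : 0 < a := Nat.pos_of_mem_divisors ha
    have hb0 : 0 < b := Nat.pos_of_ne_zero (by rintro rfl; omega)
    have key : ∀ k : ℕ, 0 < k → √(g : ℝ) ≤ k →
        (∀ x ∈ s.filter (fun j => φ j = a), ∀ y ∈ s.filter (fun j => φ j = a),
          ((W * k : ℕ) : ℤ) ∣ x - y) →
        ((s.filter (fun j => φ j = a)).card : ℝ) ≤ J / (W * √g) + 1 := by
      intro k hk hk2 hd
      have := card_le_of_dvd_sub (q := W * k) (a := -1) (S := J) (by positivity) (by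
        intro x hx
        simp only [hs, Finset.mem_filter, Finset.mem_Ico] at hx
        omega) hd
      refine this.trans ?_
      push_cast
      gcongr
    have hdb : ∀ x ∈ s.filter (fun j => φ j = a), ((W * b : ℕ) : ℤ) ∣ x - j₀ := by
      intro x hx
      obtain ⟨hx1, hx2⟩ := Finset.mem_filter.mp hx
      exact hWa x hx1 b (by rw [hx2, hb])
    have hdb2 : ∀ x ∈ s.filter (fun j => φ j = a), ∀ y ∈ s.filter (fun j => φ j = a),
        ((W * b : ℕ) : ℤ) ∣ x - y := by
      intro x hx y hy
      have := dvd_sub (hdb x hx) (hdb y hy)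
      rwa [sub_sub_sub_cancel_right] at this
    rcases le_total a b with hab | hab
    · refine key b hb0 ?_ hdb2
      rw [Real.sqrt_le_left (by positivity)]
      have : g ≤ b ^ 2 := by rw [hb]; nlinarith
      exact_mod_cast this
    -- For the larger factor a, the congruence 1 + V(x + j₀) ≡ 0 determines x modulo a, as V is
    -- invertible there; the modulus W comes from the previous congruence.
    · refine key a ha0 ?_ ?_
      · rw [Real.sqrt_le_left (by positivity)]
        have : g ≤ a ^ 2 := by rw [hb]; nlinarith
        exact_mod_cast this
      · intro x hx y hy
        have hWd : ((W : ℕ) : ℤ) ∣ x - y :=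
          (Int.natCast_dvd_natCast.mpr (Dvd.intro b rfl)).trans (hdb2 x hx y hy)
        have hx2 := (Finset.mem_filter.mp hx).2
        have hy2 := (Finset.mem_filter.mp hy).2
        have hax : (a : ℤ) ∣ 1 + V * (x + j₀) := by rw [← hx2]; exact Int.gcd_dvd_right ..
        have hay : (a : ℤ) ∣ 1 + V * (y + j₀) := by rw [← hy2]; exact Int.gcd_dvd_right ..
        have hsub : (a : ℤ) ∣ V * (x - y) := by
          have := dvd_sub hax hay
          rwa [show 1 + V * (x + j₀) - (1 + V * (y + j₀)) = V * (x - y) by ring] at this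
        have hcV : IsCoprime (a : ℤ) V := by
          obtain ⟨z, hz'⟩ := hax
          exact ⟨z, -(x + j₀), by linear_combination -hz'⟩
        have had : (a : ℤ) ∣ x - y := hcV.dvd_of_dvd_mul_left hsub
        have hcw : IsCoprime (W : ℤ) a := by
          have := hcopW x
          rw [hx2] at this
          exact (Nat.isCoprime_iff_coprime.mpr this).symm
        push_cast
        exact hcw.mul_dvd hWd had
  rw [Finset.card_eq_sum_card_fiberwise (f := φ) (t := g.divisors) hmaps]
  push_cast
  calc _ ≤ ∑ a ∈ g.divisors, ((J : ℝ) / (W * √g) + 1) := Finset.sum_le_sum hfib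
    _ = _ := by rw [Finset.sum_const, nsmul_eq_mul]

/-! ### Collisions of values of quadratic forms -/

/-- The range of the parameters `(t, u)` of the two large variables. -/
noncomputable def paramBox (T : ℤ) (S U : ℕ) : Finset (ℤ × ℤ) :=
  Finset.Ioc T (T + S) ×ˢ Finset.Ico 0 (U : ℤ)

theorem mem_paramBox {T : ℤ} {S U : ℕ} {p : ℤ × ℤ} :
    p ∈ paramBox T S U ↔ (T < p.1 ∧ p.1 ≤ T + S) ∧ (0 ≤ p.2 ∧ p.2 < U) := by
  simp [paramBox, Finset.mem_product]

theorem card_paramBox (T : ℤ) (S U : ℕ) : (paramBox T S U).card = S * U := by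
  simp [paramBox, Finset.card_product]

/-- The pairs of parameters `(t, u)`, `(t', u')` for which the values of
`(r₁ + 2Vt)² + (r₂ + 2Vu)²` differ by `4VH`. -/
noncomputable def shiftedPairs (V : ℕ) (r₁ r₂ T : ℤ) (S U : ℕ) (H : ℤ) : Finset ((ℤ × ℤ) × (ℤ × ℤ)) :=
  (paramBox T S U ×ˢ paramBox T S U).filter fun a =>
    (a.1.1 - a.2.1) * (r₁ + V * (a.1.1 + a.2.1)) =
      (a.2.2 - a.1.2) * (r₂ + V * (a.1.2 + a.2.2)) + H

theorem mem_shiftedPairs {V : ℕ} {r₁ r₂ T : ℤ} {S U : ℕ} {H : ℤ} {a : (ℤ × ℤ) × (ℤ × ℤ)} :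
    a ∈ shiftedPairs V r₁ r₂ T S U H ↔
      (((T < a.1.1 ∧ a.1.1 ≤ T + S) ∧ (0 ≤ a.1.2 ∧ a.1.2 < U)) ∧
        ((T < a.2.1 ∧ a.2.1 ≤ T + S) ∧ (0 ≤ a.2.2 ∧ a.2.2 < U))) ∧
      (a.1.1 - a.2.1) * (r₁ + V * (a.1.1 + a.2.1)) =
        (a.2.2 - a.1.2) * (r₂ + V * (a.1.2 + a.2.2)) + H := by
  simp only [shiftedPairs, Finset.mem_filter, Finset.mem_product, mem_paramBox]

/-- The shifted pairs with `t > t'`. -/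
noncomputable def risingPairs (V : ℕ) (r₁ r₂ T : ℤ) (S U : ℕ) (H : ℤ) : Finset ((ℤ × ℤ) × (ℤ × ℤ)) :=
  (shiftedPairs V r₁ r₂ T S U H).filter fun a => a.2.1 < a.1.1

/-- The shifted pairs with `t = t'`. -/
noncomputable def levelPairs (V : ℕ) (r₁ r₂ T : ℤ) (S U : ℕ) (H : ℤ) : Finset ((ℤ × ℤ) × (ℤ × ℤ)) :=
  (shiftedPairs V r₁ r₂ T S U H).filter fun a => a.1.1 = a.2.1

theorem mem_risingPairs {V : ℕ} {r₁ r₂ T : ℤ} {S U : ℕ} {H : ℤ} {a : (ℤ × ℤ) × (ℤ × ℤ)} :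
    a ∈ risingPairs V r₁ r₂ T S U H ↔
      a ∈ shiftedPairs V r₁ r₂ T S U H ∧ a.2.1 < a.1.1 := by
  simp [risingPairs]

theorem mem_levelPairs {V : ℕ} {r₁ r₂ T : ℤ} {S U : ℕ} {H : ℤ} {a : (ℤ × ℤ) × (ℤ × ℤ)} :
    a ∈ levelPairs V r₁ r₂ T S U H ↔
      a ∈ shiftedPairs V r₁ r₂ T S U H ∧ a.1.1 = a.2.1 := by
  simp [levelPairs]

theorem swap_mem_shiftedPairs {V : ℕ} {r₁ r₂ T : ℤ} {S U : ℕ} {H : ℤ} {a : (ℤ × ℤ) × (ℤ × ℤ)}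
    (h : a ∈ shiftedPairs V r₁ r₂ T S U H) : a.swap ∈ shiftedPairs V r₁ r₂ T S U (-H) := by
  rw [mem_shiftedPairs] at h ⊢
  refine ⟨⟨h.1.2, h.1.1⟩, ?_⟩
  simp only [Prod.fst_swap, Prod.snd_swap]
  linear_combination -h.2

/-- Exchanging the two points turns t < t' into t > t' and negates the shift. -/
theorem card_shiftedPairs_le (V : ℕ) (r₁ r₂ T : ℤ) (S U : ℕ) (H : ℤ) :
    (shiftedPairs V r₁ r₂ T S U H).card ≤ (risingPairs V r₁ r₂ T S U H).card +
      (risingPairs V r₁ r₂ T S U (-H)).card + (levelPairs V r₁ r₂ T S U H).card := by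
  have hsub : shiftedPairs V r₁ r₂ T S U H ⊆ risingPairs V r₁ r₂ T S U H ∪
      (risingPairs V r₁ r₂ T S U (-H)).image Prod.swap ∪ levelPairs V r₁ r₂ T S U H := by
    intro a ha
    simp only [Finset.mem_union, Finset.mem_image, mem_risingPairs, mem_levelPairs]
    rcases lt_trichotomy a.1.1 a.2.1 with h | h | h
    · exact Or.inl (Or.inr ⟨a.swap, ⟨swap_mem_shiftedPairs ha, h⟩, Prod.swap_swap a⟩)
    · exact Or.inr ⟨ha, h⟩
    · exact Or.inl (Or.inl ⟨ha, h⟩)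
  refine (Finset.card_le_card hsub).trans ((Finset.card_union_le _ _).trans ?_)
  gcongr
  refine (Finset.card_union_le _ _).trans ?_
  exact Nat.add_le_add_left Finset.card_image_le _

/-- With t = t', the difference u' - u is a nonzero divisor of H, and once it is known the equation
is linear in u. -/
theorem card_levelPairs_le {V : ℕ} {r₁ r₂ T : ℤ} {S U : ℕ} {H : ℤ} {K : ℕ} (hV : 0 < V)
    (hH : H ≠ 0) (hK : |H| ≤ K) :
    (levelPairs V r₁ r₂ T S U H).card ≤ S * (2 * K + 1) := by
  have hc : (Finset.Ioc T (T + S) ×ˢ Finset.Icc (-(K : ℤ)) K).card = S * (2 * K + 1) := by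
    rw [Finset.card_product, Int.card_Ioc, Int.card_Icc]
    congr 1 <;> omega
  rw [← hc]
  have key : ∀ a ∈ levelPairs V r₁ r₂ T S U H,
      (a.2.2 - a.1.2) * (r₂ + V * (2 * a.1.2 + (a.2.2 - a.1.2))) = -H := by
    intro a ha
    obtain ⟨h1, h2⟩ := mem_levelPairs.mp ha
    have h3 := (mem_shiftedPairs.mp h1).2
    rw [h2, sub_self, zero_mul] at h3
    linear_combination -h3
  refine Finset.card_le_card_of_injOn (fun a => (a.1.1, a.2.2 - a.1.2)) ?_ ?_
  · intro a ha
    have h1 := key a ha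
    have h2 := (mem_shiftedPairs.mp (mem_levelPairs.mp ha).1).1.1.1
    have h4 : |a.2.2 - a.1.2| ≤ |H| := by
      apply Int.le_of_dvd (abs_pos.mpr hH)
      rw [abs_dvd_abs]
      exact (dvd_neg.mp ⟨_, h1.symm⟩)
    have h5 := abs_le.mp (h4.trans hK)
    simp only [Finset.coe_product, Set.mem_prod, Finset.mem_coe, Finset.mem_Ioc, Finset.mem_Icc]
    exact ⟨h2, h5⟩
  · intro a ha a' ha' h
    simp only [Prod.mk.injEq] at h
    obtain ⟨h1, h2⟩ := h
    have k1 := key a ha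
    have k2 := key a' ha'
    rw [← h2] at k2
    have he : a.2.2 - a.1.2 ≠ 0 := by
      intro h0
      rw [h0, zero_mul] at k1
      omega
    have k3 := mul_left_cancel₀ he (k1.trans k2.symm)
    have hV' : (V : ℤ) ≠ 0 := by exact_mod_cast hV.ne'
    have k4 : (V : ℤ) * (2 * a.1.2 + (a.2.2 - a.1.2)) = V * (2 * a'.1.2 + (a.2.2 - a.1.2)) := by
      linarith
    have k5 := mul_left_cancel₀ hV' k4
    have l1 := (mem_levelPairs.mp ha).2
    have l2 := (mem_levelPairs.mp ha').2
    exact Prod.ext (Prod.ext (by omega) (by omega)) (Prod.ext (by omega) (by omega))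

theorem card_levelPairs_zero_le {V : ℕ} {r₁ r₂ T : ℤ} {S U : ℕ} (hr : 1 ≤ r₂) :
    (levelPairs V r₁ r₂ T S U 0).card ≤ S * U := by
  rw [← card_paramBox T S U]
  have key : ∀ a ∈ levelPairs V r₁ r₂ T S U 0, a.1 = a.2 := by
    intro a ha
    obtain ⟨h1, h2⟩ := mem_levelPairs.mp ha
    obtain ⟨⟨⟨_, h5, _⟩, ⟨_, h6, _⟩⟩, h3⟩ := mem_shiftedPairs.mp h1
    rw [h2, sub_self, zero_mul] at h3
    have h4 : 0 < r₂ + V * (a.1.2 + a.2.2) := by positivity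
    have h7 : a.2.2 - a.1.2 = 0 := by
      rcases mul_eq_zero.mp (show (a.2.2 - a.1.2) * (r₂ + V * (a.1.2 + a.2.2)) = 0 by linarith)
        with h | h
      · exact h
      · omega
    exact Prod.ext h2 (by omega)
  refine Finset.card_le_card_of_injOn Prod.fst ?_ ?_
  · intro a ha
    have h1 := (mem_levelPairs.mp ha).1
    exact (Finset.mem_product.mp (Finset.mem_filter.mp h1).1).1
  · intro a ha a' ha' h
    exact Prod.ext h ((key a ha).symm.trans (h.trans (key a' ha')))

/-- If `t > t'` and the shift is small, then `u' > u`. -/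
theorem lt_of_mem_risingPairs {V : ℕ} {r₁ r₂ T : ℤ} {S U : ℕ} {H : ℤ} (hr : 1 ≤ r₂)
    (h0 : 0 ≤ r₁ + V * (2 * T + 3)) (hH : H < r₁ + V * (2 * T + 3))
    {a : (ℤ × ℤ) × (ℤ × ℤ)} (ha : a ∈ risingPairs V r₁ r₂ T S U H) : a.1.2 < a.2.2 := by
  obtain ⟨h1, h2⟩ := mem_risingPairs.mp ha
  obtain ⟨⟨⟨h3, h5, _⟩, ⟨h4, h6, _⟩⟩, h⟩ := mem_shiftedPairs.mp h1
  have hV : (0 : ℤ) ≤ V := by positivity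
  have k1 : r₁ + V * (2 * T + 3) ≤ r₁ + V * (a.1.1 + a.2.1) :=
    add_le_add_right (mul_le_mul_of_nonneg_left (by omega) hV) _
  have k2 : r₁ + V * (a.1.1 + a.2.1) ≤ (a.1.1 - a.2.1) * (r₁ + V * (a.1.1 + a.2.1)) :=
    le_mul_of_one_le_left (h0.trans k1) (by omega)
  have k3 : 0 < (a.2.2 - a.1.2) * (r₂ + V * (a.1.2 + a.2.2)) := by linarith
  have k4 : 0 < r₂ + V * (a.1.2 + a.2.2) := by positivity
  have := pos_of_mul_pos_left k3 k4.le
  omega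

/-- The constant term of the linear equation in `t'` and `u` obtained by fixing `t - t' = d` and
`u' - u = e`. -/
def lineConst (V : ℕ) (r₁ r₂ H : ℤ) (p : ℕ × ℕ) : ℤ :=
  H + p.2 * r₂ + V * p.2 ^ 2 - p.1 * r₁ - V * p.1 ^ 2

/-- Each fibre of (d, e) = (t - t', u' - u) is a set of points (t', u) on one line, so `dvd_of_line`
and `card_line_le` apply. The set R is left free to be chosen as small as the geometry allows. -/
theorem card_risingPairs_le {V : ℕ} {r₁ r₂ T : ℤ} {S U : ℕ} {H : ℤ} (hV : 0 < V)
    {R : Finset (ℕ × ℕ)}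
    (hR : ∀ a ∈ risingPairs V r₁ r₂ T S U H, ((a.1.1 - a.2.1).toNat, (a.2.2 - a.1.2).toNat) ∈ R)
    (hlt : ∀ a ∈ risingPairs V r₁ r₂ T S U H, a.1.2 < a.2.2) :
    ((risingPairs V r₁ r₂ T S U H).card : ℝ) ≤ ∑ p ∈ R,
      if ((2 * V * Nat.gcd p.1 p.2 : ℕ) : ℤ) ∣ lineConst V r₁ r₂ H p then
        (S * Nat.gcd p.1 p.2 / p.2 + 1 : ℝ) else 0 := by
  rw [Finset.card_eq_sum_card_fiberwise
    (f := fun a : (ℤ × ℤ) × (ℤ × ℤ) => ((a.1.1 - a.2.1).toNat, (a.2.2 - a.1.2).toNat)) (t := R) hR]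
  rw [Nat.cast_sum]
  refine Finset.sum_le_sum fun p _ => ?_
  set F := (risingPairs V r₁ r₂ T S U H).filter
    (fun a => ((a.1.1 - a.2.1).toNat, (a.2.2 - a.1.2).toNat) = p) with hF
  have key : ∀ a ∈ F, 0 < p.2 ∧ a.1.1 = a.2.1 + p.1 ∧ a.2.2 = a.1.2 + p.2 ∧
      T < a.2.1 ∧ a.2.1 ≤ T + S ∧
      (2 * V : ℤ) * p.1 * a.2.1 - (2 * V : ℤ) * p.2 * a.1.2 = lineConst V r₁ r₂ H p := by
    intro a ha
    obtain ⟨h1, h2⟩ := Finset.mem_filter.mp ha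
    have h3 := hlt a h1
    obtain ⟨h4, h5⟩ := mem_risingPairs.mp h1
    obtain ⟨⟨_, ⟨h6, _⟩⟩, h⟩ := mem_shiftedPairs.mp h4
    have h7 : a.1.1 = a.2.1 + p.1 := by rw [← h2]; simp only; omega
    have h8 : a.2.2 = a.1.2 + p.2 := by rw [← h2]; simp only; omega
    refine ⟨by omega, h7, h8, h6.1, h6.2, ?_⟩
    rw [h7, h8] at h
    unfold lineConst
    linear_combination h
  rcases F.eq_empty_or_nonempty with he | ⟨a₀, ha₀⟩
  · rw [he]
    simp only [Finset.card_empty, Nat.cast_zero]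
    split_ifs <;> positivity
  have hdvd : ((2 * V * Nat.gcd p.1 p.2 : ℕ) : ℤ) ∣ lineConst V r₁ r₂ H p := by
    have := dvd_of_line (key a₀ ha₀).2.2.2.2.2
    push_cast at this ⊢
    exact this
  rw [if_pos hdvd]
  have hinj : Set.InjOn (fun a : (ℤ × ℤ) × (ℤ × ℤ) => (a.2.1, a.1.2)) F := by
    intro a ha a' ha' h
    simp only [Prod.mk.injEq] at h
    obtain ⟨_, k1, k2, _⟩ := key a ha
    obtain ⟨_, k3, k4, _⟩ := key a' ha'
    exact Prod.ext (Prod.ext (by omega) (by omega)) (Prod.ext (by omega) (by omega))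
  rw [← Finset.card_image_of_injOn hinj]
  refine card_line_le (W := 2 * V) (T := T) (c := lineConst V r₁ r₂ H p) (by positivity)
    (key a₀ ha₀).1 ?_
  intro q hq
  obtain ⟨a, ha, rfl⟩ := Finset.mem_image.mp hq
  obtain ⟨_, _, _, k⟩ := key a ha
  exact k

/-- For two pairs of parameters `(j, k)`, `(j', k')`, the difference of the values of
`(1 + 2Vj)² + (r + 2Vk)²`, divided by `4V`. -/
def quadDiff (V : ℕ) (r : ℤ) (b : (ℤ × ℤ) × (ℤ × ℤ)) : ℤ :=
  (b.2.1 - b.1.1) * (1 + V * (b.1.1 + b.2.1)) + (b.2.2 - b.1.2) * (r + V * (b.1.2 + b.2.2))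

/-- Pairs of parameters of the two small variables. -/
noncomputable def quads (J : ℕ) : Finset ((ℤ × ℤ) × (ℤ × ℤ)) :=
  paramBox (-1) J J ×ˢ paramBox (-1) J J

theorem mem_quads {J : ℕ} {b : (ℤ × ℤ) × (ℤ × ℤ)} : b ∈ quads J ↔
    ((0 ≤ b.1.1 ∧ b.1.1 < J) ∧ (0 ≤ b.1.2 ∧ b.1.2 < J)) ∧
      ((0 ≤ b.2.1 ∧ b.2.1 < J) ∧ (0 ≤ b.2.2 ∧ b.2.2 < J)) := by
  simp only [quads, Finset.mem_product, mem_paramBox]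
  omega

theorem card_quads (J : ℕ) : (quads J).card = J ^ 4 := by
  rw [quads, Finset.card_product, card_paramBox]; ring

theorem swap_mem_quads {J : ℕ} {b : (ℤ × ℤ) × (ℤ × ℤ)} (h : b ∈ quads J) : b.swap ∈ quads J := by
  rw [mem_quads] at h ⊢
  exact ⟨h.2, h.1⟩

theorem quadDiff_swap (V : ℕ) (r : ℤ) (b : (ℤ × ℤ) × (ℤ × ℤ)) :
    quadDiff V r b.swap = -quadDiff V r b := by
  simp only [quadDiff, Prod.fst_swap, Prod.snd_swap]; ring

/-- Fix all parameters except the j of the second point: what remains is a congruence for j + Vj²,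
uniformly in the constant. -/
theorem card_quads_filter_dvd_le {V q J : ℕ} {X : ℝ}
    (h : ∀ c : ℤ, (((Finset.Ico (0 : ℤ) J).filter
      (fun j => (q : ℤ) ∣ j + V * j ^ 2 + c)).card : ℝ) ≤ X) (r c : ℤ) :
    (((quads J).filter (fun b => (q : ℤ) ∣ quadDiff V r b + c)).card : ℝ) ≤ J ^ 3 * X := by
  let s : Finset ((ℤ × ℤ) × ℤ) :=
    (Finset.Ico (0 : ℤ) J ×ˢ Finset.Ico (0 : ℤ) J) ×ˢ Finset.Ico (0 : ℤ) J
  have hs : s.card = J ^ 3 := by simp [s, Finset.card_product]; ring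
  rw [Finset.card_eq_sum_card_fiberwise
    (f := fun b : (ℤ × ℤ) × (ℤ × ℤ) => (b.1, b.2.2)) (t := s)
    (by
      intro b hb
      have := mem_quads.mp (Finset.mem_filter.mp hb).1
      simp only [s, Finset.coe_product, Set.mem_prod, Finset.mem_coe, Finset.mem_Ico]
      exact ⟨this.1, this.2.2⟩)]
  push_cast
  have : (J : ℝ) ^ 3 * X = ∑ _ ∈ s, X := by
    rw [Finset.sum_const, hs, nsmul_eq_mul]; push_cast; ring
  rw [this]
  refine Finset.sum_le_sum fun v _ => ?_
  refine le_trans ?_ (h (-v.1.1 - V * v.1.1 ^ 2 + (v.2 - v.1.2) * (r + V * (v.1.2 + v.2)) + c))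
  norm_cast
  refine Finset.card_le_card_of_injOn (fun b => b.2.1) ?_ ?_
  · intro b hb
    obtain ⟨h1, h2⟩ := Finset.mem_filter.mp hb
    obtain ⟨h3, h4⟩ := Finset.mem_filter.mp h1
    simp only [Finset.coe_filter, Set.mem_ofPred_eq, Finset.mem_Ico]
    refine ⟨(mem_quads.mp h3).2.1, ?_⟩
    rw [← h2]
    convert h4 using 1
    simp only [quadDiff]; ring
  · intro b hb b' hb' hbb
    have h1 := (Finset.mem_filter.mp hb).2
    have h2 := (Finset.mem_filter.mp hb').2
    have h3 := h1.trans h2.symm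
    simp only [Prod.mk.injEq] at h3 hbb
    exact Prod.ext h3.1 (Prod.ext hbb h3.2)

theorem abs_quadDiff_le {V J : ℕ} {r : ℤ} (hr0 : 1 ≤ r) (hr : r ≤ 4 * V) {b : (ℤ × ℤ) × (ℤ × ℤ)}
    (hb : b ∈ quads J) : |quadDiff V r b| ≤ (10 * V * J ^ 2 : ℕ) := by
  obtain ⟨⟨⟨a1, a2⟩, a3, a4⟩, ⟨a5, a6⟩, a7, a8⟩ := mem_quads.mp hb
  have hV : (1 : ℤ) ≤ V := by omega
  have hJ : (1 : ℤ) ≤ J := by omega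
  have key : ∀ x y s : ℤ, 0 ≤ x → x < J → 0 ≤ y → y < J → 0 ≤ s → s ≤ 4 * V →
      |(y - x) * (s + V * (x + y))| ≤ 4 * V * J + 2 * V * (J - 1) * J := by
    intro x y s hx hx' hy hy' hs hs'
    rw [abs_mul, abs_of_nonneg (show 0 ≤ s + V * (x + y) by positivity)]
    have h1 : |y - x| ≤ J := abs_le.mpr ⟨by omega, by omega⟩
    have h2 : s + V * (x + y) ≤ 4 * V + V * (2 * (J - 1)) := by gcongr; omega
    calc |y - x| * (s + V * (x + y)) ≤ J * (4 * V + V * (2 * (J - 1))) := by gcongr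
      _ = _ := by ring
  have h1 := key _ _ 1 a1 a2 a5 a6 (by norm_num) (by omega)
  have h2 := key _ _ r a3 a4 a7 a8 (by omega) hr
  refine (abs_add_le _ _).trans ((add_le_add h1 h2).trans ?_)
  push_cast
  nlinarith [mul_le_mul_of_nonneg_left hJ (show (0 : ℤ) ≤ V * J by positivity)]

/-! ### Sums over pairs with given greatest common divisor -/

theorem sum_Icc_inv_le (n : ℕ) : ∑ i ∈ Finset.Icc 1 n, (i : ℝ)⁻¹ ≤ 1 + Real.log n := by
  have := harmonic_le_one_add_log n
  rw [harmonic_eq_sum_Icc] at this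
  push_cast at this
  exact this

theorem sum_Icc_cast (n : ℕ) : ∑ e ∈ Finset.Icc 1 n, (e : ℝ) = n * (n + 1) / 2 := by
  induction n with
  | zero => simp
  | succ k ih =>
    rw [Finset.sum_Icc_succ_top (by omega), ih]
    push_cast
    ring

/-- Divide both coordinates by g and forget that the quotients are coprime. -/
theorem sum_gcd_eq_le {R R' : Finset (ℕ × ℕ)} {g : ℕ} (hg : 0 < g) {F : ℕ × ℕ → ℝ}
    (hF : ∀ p, 0 ≤ F p) (h : ∀ p : ℕ × ℕ, (g * p.1, g * p.2) ∈ R → p ∈ R') :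
    ∑ p ∈ R with Nat.gcd p.1 p.2 = g, F p ≤ ∑ q ∈ R', F (g * q.1, g * q.2) := by
  have hinj : Set.InjOn (fun q : ℕ × ℕ => (g * q.1, g * q.2)) R' := by
    intro q _ q' _ hq
    simp only [Prod.mk.injEq] at hq
    exact Prod.ext (Nat.eq_of_mul_eq_mul_left hg hq.1) (Nat.eq_of_mul_eq_mul_left hg hq.2)
  rw [← Finset.sum_image hinj (f := F)]
  refine Finset.sum_le_sum_of_subset_of_nonneg ?_ fun p _ _ => hF p
  intro p hp
  obtain ⟨hp1, hp2⟩ := Finset.mem_filter.mp hp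
  obtain ⟨x, hx⟩ : g ∣ p.1 := hp2 ▸ Nat.gcd_dvd_left p.1 p.2
  obtain ⟨y, hy⟩ : g ∣ p.2 := hp2 ▸ Nat.gcd_dvd_right p.1 p.2
  have hxy : (g * x, g * y) = p := Prod.ext hx.symm hy.symm
  exact Finset.mem_image.mpr ⟨(x, y), h (x, y) (hxy ▸ hp1), hxy⟩

/-- The constraint d·T ≤ 2Ue is homogeneous, so dividing by g only shortens the range of e to U/g.
Each such e contributes at most 2U(S + U)/T, whence the saving 1/g. -/
theorem sum_gcd_weight_le {R : Finset (ℕ × ℕ)} {U : ℕ} {T S : ℝ} (hT : 0 < T) (hS : 0 ≤ S)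
    (hR : ∀ p ∈ R, 1 ≤ p.1 ∧ 1 ≤ p.2 ∧ p.2 ≤ U ∧ p.1 * T ≤ 2 * U * p.2)
    {h : ℕ → ℝ} (hh : ∀ g, 0 ≤ h g) :
    ∑ p ∈ R, h (Nat.gcd p.1 p.2) * (S * Nat.gcd p.1 p.2 / p.2 + 1) ≤
      ∑ g ∈ Finset.Icc 1 U, h g * (2 * U ^ 2 * (S + U) / T / g) := by
  rw [← Finset.sum_fiberwise_of_maps_to (s := R) (t := Finset.Icc 1 U)
    (g := fun p => Nat.gcd p.1 p.2)
    (by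
      intro p hp
      obtain ⟨h1, h2, h3, _⟩ := hR p hp
      exact Finset.mem_Icc.mpr ⟨Nat.gcd_pos_of_pos_left _ h1, (Nat.gcd_le_right _ h2).trans h3⟩)]
  refine Finset.sum_le_sum fun g hg => ?_
  have hg1 : 0 < g := (Finset.mem_Icc.mp hg).1
  have hg0 : (0 : ℝ) < g := by exact_mod_cast hg1
  have e1 : ∑ p ∈ R with Nat.gcd p.1 p.2 = g, h (Nat.gcd p.1 p.2) *
      (S * Nat.gcd p.1 p.2 / p.2 + 1) =
      h g * ∑ p ∈ R with Nat.gcd p.1 p.2 = g, (S * g / p.2 + 1) := by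
    rw [Finset.mul_sum]
    refine Finset.sum_congr rfl fun p hp => ?_
    rw [(Finset.mem_filter.mp hp).2]
  rw [e1]
  refine mul_le_mul_of_nonneg_left ?_ (hh g)
  let D : ℕ → ℕ := fun e => ⌊2 * U * (e : ℝ) / T⌋₊
  let R' : Finset (ℕ × ℕ) := (Finset.Icc 1 (U / g)).biUnion fun e =>
    (Finset.Icc 1 (D e)).image fun d => (d, e)
  refine (sum_gcd_eq_le (R' := R') hg1 (F := fun p => S * g / p.2 + 1)
    (fun p => by positivity) ?_).trans ?_
  · intro p hp
    obtain ⟨h1, h2, h3, h4⟩ := hR _ hp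
    simp only at h1 h2 h3 h4
    push_cast at h4
    simp only [R', Finset.mem_biUnion, Finset.mem_image, Finset.mem_Icc]
    refine ⟨p.2, ⟨Nat.pos_of_mul_pos_left h2, (Nat.le_div_iff_mul_le hg1).mpr (by linarith)⟩,
      p.1, ⟨Nat.pos_of_mul_pos_left h1, ?_⟩, rfl⟩
    apply Nat.le_floor
    rw [le_div_iff₀ hT]
    refine le_of_mul_le_mul_left ?_ hg0
    linarith
  · rw [Finset.sum_biUnion]
    · have e2 : ∀ e ∈ Finset.Icc 1 (U / g), ∑ q ∈ (Finset.Icc 1 (D e)).image (fun d => (d, e)),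
            (S * g / ((g * q.2 : ℕ) : ℝ) + 1) ≤ 2 * U * (S + U) / T := by
        intro e he
        obtain ⟨he1, he2⟩ := Finset.mem_Icc.mp he
        have he0 : (0 : ℝ) < e := by exact_mod_cast he1
        have heU : (e : ℝ) ≤ U := by exact_mod_cast he2.trans (Nat.div_le_self _ _)
        rw [Finset.sum_image fun a _ b _ hab => (Prod.mk.inj hab).1]
        simp only [Finset.sum_const, Nat.card_Icc, nsmul_eq_mul,
          Nat.add_sub_cancel]
        have hfl : (D e : ℝ) ≤ 2 * U * e / T := Nat.floor_le (by positivity)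
        calc (D e : ℝ) * (S * g / ((g * e : ℕ) : ℝ) + 1)
            ≤ 2 * U * e / T * (S * g / ((g * e : ℕ) : ℝ) + 1) := by gcongr
          _ = 2 * U * (S + e) / T := by push_cast; field_simp
          _ ≤ 2 * U * (S + U) / T := by gcongr
      refine (Finset.sum_le_sum e2).trans ?_
      rw [Finset.sum_const, Nat.card_Icc, Nat.add_sub_cancel, nsmul_eq_mul]
      calc ((U / g : ℕ) : ℝ) * (2 * U * (S + U) / T) ≤ (U / g : ℝ) * (2 * U * (S + U) / T) := by
            gcongr; exact Nat.cast_div_le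
        _ = _ := by field_simp
    · intro e _ e' _ hne
      simp only [Function.onFun]
      rw [Finset.disjoint_left]
      intro q hq hq'
      obtain ⟨d, _, rfl⟩ := Finset.mem_image.mp hq
      obtain ⟨d', _, h'⟩ := Finset.mem_image.mp hq'
      exact hne (Prod.mk.inj h').2.symm

theorem sum_square_gcd_weight_le (J : ℕ) :
    ∑ p ∈ Finset.Icc 1 J ×ˢ Finset.Icc 1 J, (J * Nat.gcd p.1 p.2 / p.2 + 1 : ℝ) ≤
      2 * J ^ 2 * (1 + Real.log J) ^ 2 := by
  have hlog : 0 ≤ Real.log J := Real.log_natCast_nonneg J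
  rw [← Finset.sum_fiberwise_of_maps_to (s := Finset.Icc 1 J ×ˢ Finset.Icc 1 J)
    (t := Finset.Icc 1 J) (g := fun p => Nat.gcd p.1 p.2)
    (by
      intro p hp
      obtain ⟨h1, h2⟩ := Finset.mem_product.mp hp
      rw [Finset.mem_Icc] at h1 h2
      exact Finset.mem_Icc.mpr ⟨Nat.gcd_pos_of_pos_left _ h1.1,
        (Nat.gcd_le_right _ h2.1).trans h2.2⟩)]
  have hfib : ∀ g ∈ Finset.Icc 1 J,
      ∑ p ∈ Finset.Icc 1 J ×ˢ Finset.Icc 1 J with Nat.gcd p.1 p.2 = g,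
        (J * Nat.gcd p.1 p.2 / p.2 + 1 : ℝ) ≤ 2 * J ^ 2 * (1 + Real.log J) * (g : ℝ)⁻¹ := by
    intro g hg
    have hg1 : 0 < g := (Finset.mem_Icc.mp hg).1
    have hg0 : (0 : ℝ) < g := by exact_mod_cast hg1
    have e1 : ∑ p ∈ Finset.Icc 1 J ×ˢ Finset.Icc 1 J with Nat.gcd p.1 p.2 = g,
        (J * Nat.gcd p.1 p.2 / p.2 + 1 : ℝ) =
        ∑ p ∈ Finset.Icc 1 J ×ˢ Finset.Icc 1 J with Nat.gcd p.1 p.2 = g,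
        (J * g / p.2 + 1 : ℝ) :=
      Finset.sum_congr rfl fun p hp => by rw [(Finset.mem_filter.mp hp).2]
    rw [e1]
    refine (sum_gcd_eq_le (R' := Finset.Icc 1 (J / g) ×ˢ Finset.Icc 1 (J / g)) hg1
      (F := fun p => (J * g / p.2 + 1 : ℝ)) (fun p => by positivity) ?_).trans ?_
    · intro p hp
      simp only [Finset.mem_product, Finset.mem_Icc] at hp ⊢
      exact ⟨⟨Nat.pos_of_mul_pos_left hp.1.1, (Nat.le_div_iff_mul_le hg1).mpr (by linarith)⟩,
        Nat.pos_of_mul_pos_left hp.2.1, (Nat.le_div_iff_mul_le hg1).mpr (by linarith)⟩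
    · rw [Finset.sum_product]
      simp only [Finset.sum_const, Nat.card_Icc, Nat.add_sub_cancel, nsmul_eq_mul]
      have hJg : ((J / g : ℕ) : ℝ) ≤ J / g := Nat.cast_div_le
      have hJg' : ((J / g : ℕ) : ℝ) ≤ J := by exact_mod_cast Nat.div_le_self _ _
      have e3 : ∑ e ∈ Finset.Icc 1 (J / g), (J * g / ((g * e : ℕ) : ℝ) + 1 : ℝ) ≤
          2 * J * (1 + Real.log J) := by
        have e4 : ∑ e ∈ Finset.Icc 1 (J / g), (J * g / ((g * e : ℕ) : ℝ) + 1 : ℝ) =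
            J * ∑ e ∈ Finset.Icc 1 (J / g), (e : ℝ)⁻¹ + (J / g : ℕ) := by
          rw [Finset.sum_add_distrib, Finset.mul_sum]
          congr 1
          · refine Finset.sum_congr rfl fun e he => ?_
            have : (0 : ℝ) < e := by exact_mod_cast (Finset.mem_Icc.mp he).1
            push_cast
            field_simp
          · simp
        rw [e4]
        have h1 : ∑ e ∈ Finset.Icc 1 (J / g), (e : ℝ)⁻¹ ≤ 1 + Real.log J :=
          (Finset.sum_le_sum_of_subset_of_nonneg
            (Finset.Icc_subset_Icc_right (Nat.div_le_self _ _))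
            fun _ _ _ => by positivity).trans (sum_Icc_inv_le J)
        have hJ0 : (0 : ℝ) ≤ J := by positivity
        nlinarith [mul_le_mul_of_nonneg_left h1 hJ0, mul_nonneg hJ0 hlog]
      calc ((J / g : ℕ) : ℝ) * ∑ e ∈ Finset.Icc 1 (J / g), (J * g / ((g * e : ℕ) : ℝ) + 1 : ℝ)
          ≤ (J / g) * (2 * J * (1 + Real.log J)) := by gcongr
        _ = _ := by field_simp
  refine (Finset.sum_le_sum hfib).trans ?_
  rw [← Finset.mul_sum]
  calc _ ≤ 2 * (J : ℝ) ^ 2 * (1 + Real.log J) * (1 + Real.log J) := by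
        gcongr; exact sum_Icc_inv_le J
    _ = _ := by ring

theorem card_le_sub_add_one {s : Finset ℕ} {a b : ℝ} (hab : a ≤ b)
    (h : ∀ x ∈ s, a ≤ x ∧ (x : ℝ) ≤ b) : (s.card : ℝ) ≤ b - a + 1 := by
  rcases s.eq_empty_or_nonempty with rfl | hs
  · simp; linarith
  have h1 : s ⊆ Finset.Icc (s.min' hs) (s.max' hs) := fun x hx =>
    Finset.mem_Icc.mpr ⟨s.min'_le x hx, s.le_max' x hx⟩
  have h2 := Finset.card_le_card h1
  rw [Nat.card_Icc] at h2
  have h3 := s.min'_le_max' hs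
  have h4 : s.card + s.min' hs ≤ s.max' hs + 1 := by omega
  have h5 : (s.card : ℝ) + (s.min' hs : ℕ) ≤ (s.max' hs : ℕ) + 1 := by exact_mod_cast h4
  have h6 := (h _ (s.min'_mem hs)).1
  have h7 := (h _ (s.max'_mem hs)).2
  linarith

/-- The region that contains the differences `(t - t', u' - u)` for shifts of size at most `K`. -/
def diffRegion (T S U K : ℕ) : Finset (ℕ × ℕ) :=
  (Finset.Icc 1 S ×ˢ Finset.Icc 1 U).filter fun p =>
    2 * p.1 * T + p.2 ^ 2 ≤ p.2 * (2 * U + 4) + K ∧ p.2 ^ 2 ≤ 2 * p.1 * (T + S + 2) + K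

theorem mem_diffRegion_bounds {T S U K : ℕ} (hU : K + 4 ≤ 2 * U) {p : ℕ × ℕ}
    (hp : p ∈ diffRegion T S U K) :
    1 ≤ p.1 ∧ 1 ≤ p.2 ∧ p.2 ≤ U ∧ (p.1 : ℝ) * (T : ℝ) ≤ 2 * U * p.2 := by
  simp only [diffRegion, Finset.mem_filter, Finset.mem_product, Finset.mem_Icc] at hp
  obtain ⟨⟨⟨h1, _⟩, h3, h4⟩, h5, _⟩ := hp
  refine ⟨h1, h3, h4, ?_⟩
  have : p.1 * T ≤ 2 * U * p.2 := by nlinarith [Nat.zero_le (p.2 ^ 2), Nat.zero_le K]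
  exact_mod_cast this

/-- For given e, the two inequalities of the region confine d to an interval of length about (eU -
e²)/T. Weighting by S/e and summing over e ≤ U gives the main term SU²/(2T). The term with (S +
2)/(4T) pays for the variation of t across the box, and the logarithm for K and for rounding. -/
theorem sum_diffRegion_le {T S U K : ℕ} (hT : 0 < T) (hU : K + 4 ≤ 2 * U) :
    ∑ p ∈ diffRegion T S U K, (S / p.2 + 1 : ℝ) ≤
      S / T * ((U ^ 2 + 3 * U) / 2 + (S + 2) * (U * (U + 1)) / (4 * T) +
        (K + T) * (1 + Real.log U)) + U ^ 2 * (U + 1) / T := by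
  have hT' : (0 : ℝ) < T := by exact_mod_cast hT
  have hsum : ∀ f : ℕ → ℝ, ∑ p ∈ diffRegion T S U K, f p.2 = ∑ e ∈ Finset.Icc 1 U,
      (((diffRegion T S U K).filter fun p => p.2 = e).card : ℝ) * f e := by
    intro f
    rw [← Finset.sum_fiberwise_of_maps_to (s := diffRegion T S U K) (t := Finset.Icc 1 U)
      (g := fun p => p.2)
      (fun p hp => by
        have := mem_diffRegion_bounds hU hp
        exact Finset.mem_Icc.mpr ⟨this.2.1, this.2.2.1⟩)]
    refine Finset.sum_congr rfl fun e _ => ?_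
    rw [Finset.sum_congr rfl (g := fun _ => f e)
      (fun p hp => by rw [(Finset.mem_filter.mp hp).2]), Finset.sum_const, nsmul_eq_mul]
  have hcard : ∀ e : ℕ, ∀ a b : ℝ, a ≤ b →
      (∀ p ∈ diffRegion T S U K, p.2 = e → a ≤ p.1 ∧ (p.1 : ℝ) ≤ b) →
      (((diffRegion T S U K).filter fun p => p.2 = e).card : ℝ) ≤ b - a + 1 := by
    intro e a b hab h
    have hinj : Set.InjOn Prod.fst
        (((diffRegion T S U K).filter fun p => p.2 = e : Finset (ℕ × ℕ)) : Set (ℕ × ℕ)) := by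
      intro p hp q hq hpq
      exact Prod.ext hpq
        ((Finset.mem_filter.mp hp).2.trans (Finset.mem_filter.mp hq).2.symm)
    rw [← Finset.card_image_of_injOn hinj]
    refine card_le_sub_add_one hab ?_
    intro x hx
    obtain ⟨p, hp, rfl⟩ := Finset.mem_image.mp hx
    obtain ⟨hp1, hp2⟩ := Finset.mem_filter.mp hp
    exact h p hp1 hp2
  have hone : ∑ p ∈ diffRegion T S U K, (1 : ℝ) ≤ U ^ 2 * (U + 1) / T := by
    rw [hsum (fun _ => 1)]
    have h1 : ∀ e ∈ Finset.Icc 1 U,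
        (((diffRegion T S U K).filter fun p => p.2 = e).card : ℝ) * 1 ≤ 2 * U / T * e := by
      intro e _
      rw [mul_one]
      -- A nonempty fibre forces 2Ue/T ≥ 1, so the lower end 1 of the interval cancels the extra 1
      -- in the count.
      have := hcard e 1 (max 1 (2 * U * e / T)) (le_max_left _ _) (by
        rintro p hp rfl
        obtain ⟨k1, _, _, k4⟩ := mem_diffRegion_bounds hU hp
        exact ⟨by exact_mod_cast k1, le_max_of_le_right (by rw [le_div_iff₀ hT']; exact k4)⟩)
      rcases ((diffRegion T S U K).filter fun p => p.2 = e).eq_empty_or_nonempty with h0 | ⟨p, hp⟩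
      · rw [h0, Finset.card_empty, Nat.cast_zero]; positivity
      · obtain ⟨hp1, hp2⟩ := Finset.mem_filter.mp hp
        obtain ⟨k1, _, _, k4⟩ := mem_diffRegion_bounds hU hp1
        have k1' : (1 : ℝ) ≤ p.1 := by exact_mod_cast k1
        have h2 : 1 ≤ 2 * U * (e : ℝ) / T := by
          rw [le_div_iff₀ hT', ← hp2]
          nlinarith
        rw [max_eq_right h2] at this
        calc _ ≤ _ := this
          _ = _ := by ring
    refine (Finset.sum_le_sum h1).trans ?_
    rw [← Finset.mul_sum]
    rw [sum_Icc_cast]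
    apply le_of_eq; field_simp
  have hmain : ∑ p ∈ diffRegion T S U K, (S / p.2 : ℝ) ≤
      S / T * ((U ^ 2 + 3 * U) / 2 + (S + 2) * (U * (U + 1)) / (4 * T) +
        (K + T) * (1 + Real.log U)) := by
    rw [hsum (fun e => (S / e : ℝ))]
    have h1 : ∀ e ∈ Finset.Icc 1 U,
        (((diffRegion T S U K).filter fun p => p.2 = e).card : ℝ) * (S / e) ≤
          S / T * (U + 2) + S / T * ((S + 2) / (2 * T) - 1) * e + S / T * (K + T) * (e : ℝ)⁻¹ := by
      intro e he
      obtain ⟨he1, he2⟩ := Finset.mem_Icc.mp he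
      have he0 : (0 : ℝ) < e := by exact_mod_cast he1
      have heU : (e : ℝ) ≤ U := by exact_mod_cast he2
      -- `hcard` needs ordered endpoints for every e, including those with an empty fibre.
      have hb : ((e : ℝ) ^ 2 - K) / (2 * (T + S + 2)) ≤ (e * (2 * U + 4 - e) + K) / (2 * T) := by
        rcases le_total ((e : ℝ) ^ 2) K with h | h
        · calc ((e : ℝ) ^ 2 - K) / (2 * (T + S + 2)) ≤ 0 :=
              div_nonpos_of_nonpos_of_nonneg (by linarith) (by positivity)
            _ ≤ _ := div_nonneg (by nlinarith [Nat.cast_nonneg (α := ℝ) K]) (by positivity)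
        · have hS0 : (0 : ℝ) ≤ S := by positivity
          have hK0 : (0 : ℝ) ≤ K := by positivity
          have hUe : 0 ≤ (e : ℝ) * (U - e) := mul_nonneg he0.le (by linarith)
          exact div_le_div₀ (by nlinarith) (by nlinarith) (by positivity) (by linarith)
      have h2 := hcard e _ _ hb (by
        rintro p hp rfl
        simp only [diffRegion, Finset.mem_filter] at hp
        obtain ⟨_, k1, k2⟩ := hp
        have k1' : 2 * (p.1 : ℝ) * T + p.2 ^ 2 ≤ p.2 * (2 * U + 4) + K := by exact_mod_cast k1
        have k2' : (p.2 : ℝ) ^ 2 ≤ 2 * p.1 * (T + S + 2) + K := by exact_mod_cast k2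
        constructor
        · rw [div_le_iff₀ (by positivity)]; linarith
        · rw [le_div_iff₀ (by positivity)]; linarith)
      have h3 : (e * (2 * U + 4 - e) + K) / (2 * T) - ((e : ℝ) ^ 2 - K) / (2 * (T + S + 2)) + 1
          ≤ e * (U + 2) / T + e ^ 2 * ((S + 2) / (2 * T) - 1) / T + (K + T) / T := by
        have h4 : (e : ℝ) ^ 2 / (2 * T) - e ^ 2 / (2 * (T + S + 2)) ≤
            e ^ 2 * (S + 2) / (2 * T * T) := by
          rw [div_sub_div _ _ (by positivity) (by positivity)]
          rw [div_le_div_iff₀ (by positivity) (by positivity)]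
          have : 0 ≤ (e : ℝ) ^ 2 * T * T * (S + 2) ^ 2 := by positivity
          have : 0 ≤ (e : ℝ) ^ 2 * T * (S + 2) * (S + 2) := by positivity
          nlinarith
        have h5 : (K : ℝ) / (2 * (T + S + 2)) ≤ K / (2 * T) := by
          gcongr
          have hS0 : (0 : ℝ) ≤ S := by positivity
          linarith
        have e1 : (e * (2 * U + 4 - e) + K) / (2 * T) - ((e : ℝ) ^ 2 - K) / (2 * (T + S + 2)) + 1
          = e * (U + 2) / T - e ^ 2 / T + ((e : ℝ) ^ 2 / (2 * T) - e ^ 2 / (2 * (T + S + 2)))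
            + K / (2 * T) + K / (2 * (T + S + 2)) + 1 := by
          field_simp; ring
        have e2 : e * (U + 2) / T + e ^ 2 * ((S + 2) / (2 * T) - 1) / T + (K + T) / T
          = e * (U + 2) / T - e ^ 2 / T + (e : ℝ) ^ 2 * (S + 2) / (2 * T * T)
            + K / (2 * T) + K / (2 * T) + 1 := by
          field_simp; ring
        rw [e1, e2]
        gcongr
      calc (((diffRegion T S U K).filter fun p => p.2 = e).card : ℝ) * (S / e)
          ≤ (e * (U + 2) / T + e ^ 2 * ((S + 2) / (2 * T) - 1) / T + (K + T) / T) * (S / e) := by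
            gcongr
            exact h2.trans h3
        _ = S / T * (U + 2) + S / T * ((S + 2) / (2 * T) - 1) * e + S / T * (K + T) * (e : ℝ)⁻¹ := by
            field_simp
    refine (Finset.sum_le_sum h1).trans ?_
    rw [Finset.sum_add_distrib, Finset.sum_add_distrib, ← Finset.mul_sum, ← Finset.mul_sum,
      sum_Icc_cast, Finset.sum_const, Nat.card_Icc, Nat.add_sub_cancel, nsmul_eq_mul]
    calc _ ≤ U * (S / T * (U + 2)) + S / T * ((S + 2) / (2 * T) - 1) * (U * (U + 1) / 2)
          + S / T * (K + T) * (1 + Real.log U) := by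
          rw [← Finset.mul_sum]
          exact add_le_add (le_of_eq (by ring)) (mul_le_mul_of_nonneg_left (sum_Icc_inv_le U) (by positivity))
      _ = _ := by field_simp; ring
  rw [Finset.sum_add_distrib]
  exact add_le_add hmain hone

/-! ### The number of collisions -/

/-- A vanishing shift is itself a collision of a binary form, with first residue 1 and a square
parameter box; the left end is -1 because that box is open on the left. The gcd sum costs two
logarithms of J. -/
theorem card_quads_quadDiff_zero_le {V J : ℕ} {r : ℤ} (hV : 0 < V) (hr : 1 ≤ r) :
    (((quads J).filter fun b => quadDiff V r b = 0).card : ℝ) ≤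
      5 * J ^ 2 * (1 + Real.log J) ^ 2 := by
  have hsub : (quads J).filter (fun b => quadDiff V r b = 0) ⊆ shiftedPairs V 1 r (-1) J J 0 := by
    intro b hb
    obtain ⟨h1, h2⟩ := Finset.mem_filter.mp hb
    obtain ⟨⟨⟨a1, a2⟩, a3, a4⟩, ⟨a5, a6⟩, a7, a8⟩ := mem_quads.mp h1
    rw [mem_shiftedPairs]
    refine ⟨by omega, ?_⟩
    unfold quadDiff at h2
    linear_combination -h2
  have h1 := (Finset.card_le_card hsub).trans (card_shiftedPairs_le V 1 r (-1) J J 0)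
  rw [neg_zero] at h1
  have h2 := card_levelPairs_zero_le (V := V) (r₁ := 1) (T := -1) (S := J) (U := J) hr
  have hlt : ∀ a ∈ risingPairs V 1 r (-1) J J 0, a.1.2 < a.2.2 :=
    fun a ha => lt_of_mem_risingPairs hr (by positivity) (by positivity) ha
  have h3 := card_risingPairs_le (V := V) (r₁ := 1) (r₂ := r) (T := -1) (S := J) (U := J) (H := 0)
    hV (R := Finset.Icc 1 J ×ˢ Finset.Icc 1 J) (by
      intro a ha
      have k1 := hlt a ha
      obtain ⟨k2, k3⟩ := mem_risingPairs.mp ha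
      obtain ⟨k4, _⟩ := mem_shiftedPairs.mp k2
      simp only [Finset.mem_product, Finset.mem_Icc]
      omega) hlt
  have h4 : ((risingPairs V 1 r (-1) J J 0).card : ℝ) ≤ 2 * J ^ 2 * (1 + Real.log J) ^ 2 := by
    refine h3.trans (le_trans (Finset.sum_le_sum fun p _ => ?_) (sum_square_gcd_weight_le J))
    split_ifs
    · exact le_rfl
    · positivity
  have h5 : (((quads J).filter fun b => quadDiff V r b = 0).card : ℝ) ≤
      (risingPairs V 1 r (-1) J J 0).card + (risingPairs V 1 r (-1) J J 0).card + J * J := by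
    exact_mod_cast h1.trans (Nat.add_le_add_left h2 _)
  have hlog : 0 ≤ Real.log J := Real.log_natCast_nonneg J
  have hJ : (J : ℝ) ^ 2 * 1 ≤ J ^ 2 * (1 + Real.log J) ^ 2 := by
    gcongr
    nlinarith
  nlinarith

section

variable {V T S U J K w : ℕ} {r₁ r₂ r₄ : ℤ}

/-- With e = u' - u the sum u + u' lies between e and 2U - e, while t + t' lies between 2T and 2(T +
S). The residues are at most 4V, which after division by V accounts for the added 4 and 2 in the
region. -/
theorem mem_diffRegion_of_mem_risingPairs (hV : 0 < V) (h₁ : 1 ≤ r₁) (h₁' : r₁ ≤ 4 * V)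
    (h₂ : 1 ≤ r₂) (h₂' : r₂ ≤ 4 * V) (hK : K < 2 * T) {H : ℤ} (hH : |H| ≤ K)
    {a : (ℤ × ℤ) × (ℤ × ℤ)} (ha : a ∈ risingPairs V r₁ r₂ T S U H) :
    a.1.2 < a.2.2 ∧ ((a.1.1 - a.2.1).toNat, (a.2.2 - a.1.2).toNat) ∈ diffRegion T S U K := by
  obtain ⟨hH1, hH2⟩ := abs_le.mp hH
  have hV1 : (1 : ℤ) ≤ V := by exact_mod_cast hV
  have hT0 : (0 : ℤ) ≤ 2 * T + 3 := by positivity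
  have hVT : (2 * T + 3 : ℤ) ≤ V * (2 * T + 3) := le_mul_of_one_le_left hT0 hV1
  have hlt := lt_of_mem_risingPairs h₂ (by linarith) (by omega) ha
  refine ⟨hlt, ?_⟩
  obtain ⟨h1, h2⟩ := mem_risingPairs.mp ha
  obtain ⟨⟨⟨⟨k1, k2⟩, k3, k4⟩, ⟨k5, k6⟩, k7, k8⟩, h⟩ := mem_shiftedPairs.mp h1
  obtain ⟨d, hd⟩ := Int.eq_ofNat_of_zero_le (show 0 ≤ a.1.1 - a.2.1 by omega)
  obtain ⟨e, he⟩ := Int.eq_ofNat_of_zero_le (show 0 ≤ a.2.2 - a.1.2 by omega)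
  rw [hd, he] at h ⊢
  have hV0 : (0 : ℤ) < V := by omega
  have hd0 : (0 : ℤ) ≤ d := by positivity
  have he0 : (0 : ℤ) ≤ e := by positivity
  simp only [Int.toNat_natCast] at h ⊢
  simp only [diffRegion, Finset.mem_filter, Finset.mem_product, Finset.mem_Icc]
  refine ⟨⟨⟨by omega, by omega⟩, by omega, by omega⟩, ?_, ?_⟩
  · have : (2 * d * T + e ^ 2 : ℤ) ≤ e * (2 * U + 4) + K := by
      have l1 : (d : ℤ) * (V * (2 * T)) ≤ d * (r₁ + V * (a.1.1 + a.2.1)) := by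
        have : (V : ℤ) * (2 * T) ≤ V * (a.1.1 + a.2.1) :=
          mul_le_mul_of_nonneg_left (by omega) hV0.le
        exact mul_le_mul_of_nonneg_left (by linarith) hd0
      have l2 : (e : ℤ) * (r₂ + V * (a.1.2 + a.2.2)) ≤ e * (4 * V + V * (2 * U - e)) := by
        have : (V : ℤ) * (a.1.2 + a.2.2) ≤ V * (2 * U - e) :=
          mul_le_mul_of_nonneg_left (by omega) hV0.le
        exact mul_le_mul_of_nonneg_left (by linarith) he0
      have l3 : (K : ℤ) ≤ V * K := le_mul_of_one_le_left (by positivity) hV1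
      refine le_of_mul_le_mul_left ?_ hV0
      linarith
    exact_mod_cast this
  · have : (e ^ 2 : ℤ) ≤ 2 * d * (T + S + 2) + K := by
      have l1 : (d : ℤ) * (r₁ + V * (a.1.1 + a.2.1)) ≤ d * (4 * V + V * (2 * (T + S))) := by
        have : (V : ℤ) * (a.1.1 + a.2.1) ≤ V * (2 * (T + S)) :=
          mul_le_mul_of_nonneg_left (by omega) hV0.le
        exact mul_le_mul_of_nonneg_left (by linarith) hd0
      have l2 : (e : ℤ) * (V * e) ≤ e * (r₂ + V * (a.1.2 + a.2.2)) := by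
        have : (V : ℤ) * e ≤ V * (a.1.2 + a.2.2) :=
          mul_le_mul_of_nonneg_left (by omega) hV0.le
        exact mul_le_mul_of_nonneg_left (by linarith) he0
      have l3 : (K : ℤ) ≤ V * K := le_mul_of_one_le_left (by positivity) hV1
      refine le_of_mul_le_mul_left ?_ hV0
      linarith
    exact_mod_cast this

/-- All divisibility conditions are dropped here. The resulting log U is affordable because zero
shifts are rare. -/
theorem card_risingPairs_zero_le (hV : 0 < V) (h₁ : 1 ≤ r₁) (h₁' : r₁ ≤ 4 * V)
    (h₂ : 1 ≤ r₂) (h₂' : r₂ ≤ 4 * V) (hT : 0 < T) (hU : 2 ≤ U) :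
    ((risingPairs V r₁ r₂ T S U 0).card : ℝ) ≤
      2 * U ^ 2 * (S + U) / T * (1 + Real.log U) := by
  have key := fun a (ha : a ∈ risingPairs V r₁ r₂ T S U 0) =>
    mem_diffRegion_of_mem_risingPairs (K := 0) hV h₁ h₁' h₂ h₂' (by omega) (by simp) ha
  refine (card_risingPairs_le hV (fun a ha => (key a ha).2) (fun a ha => (key a ha).1)).trans ?_
  calc _ ≤ ∑ p ∈ diffRegion T S U 0, 1 * (S * Nat.gcd p.1 p.2 / p.2 + 1 : ℝ) := by
        refine Finset.sum_le_sum fun p _ => ?_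
        rw [one_mul]
        split_ifs
        · exact le_rfl
        · positivity
    _ ≤ ∑ g ∈ Finset.Icc 1 U, 1 * (2 * U ^ 2 * (S + U) / T / g : ℝ) :=
        sum_gcd_weight_le (h := fun _ => 1) (by exact_mod_cast hT) (by positivity)
          (fun p hp => mem_diffRegion_bounds (by omega) hp) (fun _ => zero_le_one)
    _ = 2 * U ^ 2 * (S + U) / T * ∑ g ∈ Finset.Icc 1 U, (g : ℝ)⁻¹ := by
        rw [Finset.mul_sum]
        exact Finset.sum_congr rfl fun g _ => by rw [one_mul, div_eq_mul_inv _ (g : ℝ)]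
    _ ≤ _ := by gcongr; exact sum_Icc_inv_le U

/-- The total number of solutions with `t > t'` and nonzero shift. -/
theorem sum_card_risingPairs_le (h2V : 2 ∣ V) (hV : 0 < V)
    (hw : ∀ p : ℕ, p.Prime → p ≤ w → p ∣ V)
    (h₁ : 1 ≤ r₁) (h₁' : r₁ ≤ 4 * V) (h₂ : 1 ≤ r₂) (h₂' : r₂ ≤ 4 * V) (h₄ : 1 ≤ r₄)
    (h₄' : r₄ ≤ 4 * V) (hK : 10 * V * J ^ 2 ≤ K) (hT : K < 2 * T) (hU : K + 4 ≤ 2 * U) :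
    ∑ b ∈ (quads J).filter (fun b => quadDiff V r₄ b ≠ 0),
      ((risingPairs V r₁ r₂ T S U (quadDiff V r₄ b)).card : ℝ) ≤
    (J ^ 4 / (2 * V) + w * J ^ 3) * (∑ p ∈ diffRegion T S U K, (S / p.2 + 1 : ℝ)) +
      J ^ 3 * (2 * U ^ 2 * (S + U) / T) *
        ∑ g ∈ Finset.Ioc w K, g.divisors.card * (J / (2 * V * √g) + 1) / (g : ℝ) := by
  have hVp : ∀ p : ℕ, p.Prime → p ∣ 2 * V → p ∣ V := by
    intro p hp hd
    rcases (Nat.Prime.dvd_mul hp).mp hd with h | h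
    · rw [(Nat.prime_dvd_prime_iff_eq hp Nat.prime_two).mp h]; exact h2V
    · exact h
  have hV' : (0 : ℝ) < V := by exact_mod_cast hV
  have hT0 : 0 < T := by omega
  have hT' : (0 : ℝ) < T := by exact_mod_cast hT0
  have habs : ∀ b ∈ quads J, |quadDiff V r₄ b| ≤ K := fun b hb =>
    (abs_quadDiff_le h₄ h₄' hb).trans (by exact_mod_cast hK)
  -- After exchanging the sums, the count for each difference pair is the number of nonzero shifts
  -- that pass its divisibility test.
  let N : ℕ × ℕ → ℕ := fun p => (((quads J).filter (fun b => quadDiff V r₄ b ≠ 0)).filter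
    fun b => ((2 * V * Nat.gcd p.1 p.2 : ℕ) : ℤ) ∣ lineConst V r₁ r₂ (quadDiff V r₄ b) p).card
  have hN : ∑ b ∈ (quads J).filter (fun b => quadDiff V r₄ b ≠ 0),
      ((risingPairs V r₁ r₂ T S U (quadDiff V r₄ b)).card : ℝ) ≤
      ∑ p ∈ diffRegion T S U K, N p * (S * Nat.gcd p.1 p.2 / p.2 + 1 : ℝ) := by
    calc _ ≤ ∑ b ∈ (quads J).filter (fun b => quadDiff V r₄ b ≠ 0),
          ∑ p ∈ diffRegion T S U K,
            if ((2 * V * Nat.gcd p.1 p.2 : ℕ) : ℤ) ∣ lineConst V r₁ r₂ (quadDiff V r₄ b) p then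
            (S * Nat.gcd p.1 p.2 / p.2 + 1 : ℝ) else 0 := by
          refine Finset.sum_le_sum fun b hb => ?_
          have key := fun a (ha : a ∈ risingPairs V r₁ r₂ T S U (quadDiff V r₄ b)) =>
            mem_diffRegion_of_mem_risingPairs hV h₁ h₁' h₂ h₂' hT
              (habs b (Finset.mem_filter.mp hb).1) ha
          exact card_risingPairs_le hV (fun a ha => (key a ha).2) (fun a ha => (key a ha).1)
      _ = _ := by
          rw [Finset.sum_comm]
          refine Finset.sum_congr rfl fun p _ => ?_
          rw [← Finset.sum_filter, Finset.sum_const, nsmul_eq_mul]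
  have hfil : ∀ p : ℕ × ℕ, ∀ X : ℝ, (∀ c : ℤ, (((Finset.Ico (0 : ℤ) J).filter
      (fun j => ((2 * V * Nat.gcd p.1 p.2 : ℕ) : ℤ) ∣ j + V * j ^ 2 + c)).card : ℝ) ≤ X) →
      (N p : ℝ) ≤ J ^ 3 * X := by
    intro p X hX
    refine le_trans ?_ (card_quads_filter_dvd_le hX r₄
      (p.2 * r₂ + V * p.2 ^ 2 - p.1 * r₁ - V * p.1 ^ 2))
    refine Nat.cast_le.mpr (Finset.card_le_card ?_)
    intro b hb
    obtain ⟨k1, k2⟩ := Finset.mem_filter.mp hb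
    refine Finset.mem_filter.mpr ⟨(Finset.mem_filter.mp k1).1, ?_⟩
    convert k2 using 1
    simp only [lineConst]
    ring
  let h : ℕ → ℝ := fun g =>
    if w < g ∧ g ≤ K then J ^ 3 * (g.divisors.card * (J / (2 * V * √g) + 1)) else 0
  have hterm : ∀ p ∈ diffRegion T S U K, N p * (S * Nat.gcd p.1 p.2 / p.2 + 1 : ℝ) ≤
      (J ^ 4 / (2 * V) + w * J ^ 3) * (S / p.2 + 1) +
        h (Nat.gcd p.1 p.2) * (S * Nat.gcd p.1 p.2 / p.2 + 1) := by
    intro p hp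
    obtain ⟨hp1, hp2, _, _⟩ := mem_diffRegion_bounds hU hp
    have hg : 0 < Nat.gcd p.1 p.2 := Nat.gcd_pos_of_pos_left _ hp1
    have hd1 := Nat.gcd_dvd_left p.1 p.2
    have hd2 := Nat.gcd_dvd_right p.1 p.2
    set g := Nat.gcd p.1 p.2
    have hg0 : (1 : ℝ) ≤ g := by exact_mod_cast hg
    have hp20 : (0 : ℝ) < p.2 := by exact_mod_cast hp2
    rcases Nat.lt_or_ge w g with hwg | hwg
    · rcases Nat.lt_or_ge K g with hKg | hKg
      -- Here g divides d and e, so it would divide the nonzero shift, whose absolute value is at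
      -- most K < g.
      · have h0 : N p = 0 := by
          refine Finset.card_eq_zero.mpr (Finset.filter_eq_empty_iff.mpr ?_)
          intro b hb hdvd
          obtain ⟨k1, k2⟩ := Finset.mem_filter.mp hb
          have k3 : (g : ℤ) ∣ lineConst V r₁ r₂ (quadDiff V r₄ b) p :=
            (Int.natCast_dvd_natCast.mpr (Dvd.intro_left _ rfl)).trans hdvd
          have k4 : (g : ℤ) ∣ (p.1 : ℤ) := Int.natCast_dvd_natCast.mpr hd1
          have k5 : (g : ℤ) ∣ (p.2 : ℤ) := Int.natCast_dvd_natCast.mpr hd2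
          have k6 : (g : ℤ) ∣ quadDiff V r₄ b := by
            have : quadDiff V r₄ b = lineConst V r₁ r₂ (quadDiff V r₄ b) p -
                p.2 * (r₂ + V * p.2) + p.1 * (r₁ + V * p.1) := by
              simp only [lineConst]; ring
            rw [this]
            exact dvd_add (dvd_sub k3 (k5.mul_right _)) (k4.mul_right _)
          have k7 := Int.le_of_dvd (abs_pos.mpr k2) ((dvd_abs _ _).mpr k6)
          have k8 := habs b k1
          omega
        rw [h0, Nat.cast_zero, zero_mul]
        have : 0 ≤ h g := by simp only [h]; split_ifs <;> positivity
        positivity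
      · have hb : (N p : ℝ) ≤ h g := by
          simp only [h]
          rw [if_pos ⟨hwg, hKg⟩]
          refine hfil p _ fun c => ?_
          have := card_quadratic_le (V := V) (W := 2 * V) (J := J) (by omega) hg hVp c
          push_cast at this ⊢
          exact this
        have : (0 : ℝ) ≤ (J ^ 4 / (2 * V) + w * J ^ 3) * (S / p.2 + 1) := by positivity
        have := mul_le_mul_of_nonneg_right hb (show (0 : ℝ) ≤ S * g / p.2 + 1 by positivity)
        linarith
    -- For g ≤ w every prime of 2Vg divides V. The frequency 1/(2Vg) cancels the factor g in the
    -- number of points on the line; rounding leaves the term wJ³.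
    · have hb : (N p : ℝ) ≤ J ^ 3 * (J / (2 * V * g) + 1) := by
        refine hfil p _ fun c => ?_
        have := card_quadratic_le_of_smooth (V := V) (q := 2 * V * g) (J := J) (by positivity)
          (by
            intro q hq hqd
            rcases (Nat.Prime.dvd_mul hq).mp hqd with hh | hh
            · exact hVp q hq hh
            · exact hw q hq ((Nat.le_of_dvd hg hh).trans hwg)) c
        push_cast at this ⊢
        exact this
      have hwg' : (g : ℝ) ≤ w := by exact_mod_cast hwg
      have hh : 0 ≤ h g * (S * g / p.2 + 1) := by
        have : 0 ≤ h g := by simp only [h]; split_ifs <;> positivity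
        positivity
      have e1 : (S * g / p.2 + 1 : ℝ) ≤ g * (S / p.2 + 1) := by
        rw [mul_add, mul_one]
        have : (S * g / p.2 : ℝ) = g * (S / p.2) := by ring
        linarith
      calc N p * (S * g / p.2 + 1 : ℝ)
          ≤ (J ^ 3 * (J / (2 * V * g) + 1)) * (g * (S / p.2 + 1)) := by gcongr
        _ = (J ^ 4 / (2 * V) + g * J ^ 3) * (S / p.2 + 1) := by field_simp
        _ ≤ (J ^ 4 / (2 * V) + w * J ^ 3) * (S / p.2 + 1) := by gcongr
        _ ≤ _ := by linarith
  refine hN.trans ((Finset.sum_le_sum hterm).trans ?_)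
  rw [Finset.sum_add_distrib, ← Finset.mul_sum]
  refine add_le_add le_rfl ?_
  refine (sum_gcd_weight_le (U := U) hT' (Nat.cast_nonneg S)
    (fun p hp => mem_diffRegion_bounds hU hp) (h := h)
    (fun g => by simp only [h]; split_ifs <;> positivity)).trans ?_
  simp only [h, ite_mul, zero_mul]
  rw [← Finset.sum_filter, Finset.mul_sum]
  calc _ ≤ ∑ g ∈ Finset.Ioc w K, (J ^ 3 * (g.divisors.card * (J / (2 * V * √g) + 1)) *
        (2 * U ^ 2 * (S + U) / T / g) : ℝ) := by
        refine Finset.sum_le_sum_of_subset_of_nonneg ?_ fun g _ _ => by positivity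
        intro g hg
        exact Finset.mem_Ioc.mpr (Finset.mem_filter.mp hg).2
    _ = _ := Finset.sum_congr rfl fun g _ => by ring

/-- The value of the form `(r₁ + 2Vt)² + (r₂ + 2Vu)² + (1 + 2Vj)² + (r₄ + 2Vk)²`. -/
def formValue (V : ℕ) (r₁ r₂ r₄ : ℤ) (p : (ℤ × ℤ) × (ℤ × ℤ)) : ℤ :=
  (r₁ + 2 * V * p.1.1) ^ 2 + (r₂ + 2 * V * p.1.2) ^ 2 + (1 + 2 * V * p.2.1) ^ 2 +
    (r₄ + 2 * V * p.2.2) ^ 2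

/-- The parameters of the four variables. -/
noncomputable def formBox (T S U J : ℕ) : Finset ((ℤ × ℤ) × (ℤ × ℤ)) :=
  paramBox T S U ×ˢ paramBox (-1) J J

/-- The pairs of parameters with equal values of the form. -/
noncomputable def collisions (V : ℕ) (r₁ r₂ r₄ : ℤ) (T S U J : ℕ) :
    Finset (((ℤ × ℤ) × (ℤ × ℤ)) × ((ℤ × ℤ) × (ℤ × ℤ))) :=
  (formBox T S U J ×ˢ formBox T S U J).filter fun q =>
    formValue V r₁ r₂ r₄ q.1 = formValue V r₁ r₂ r₄ q.2

theorem card_collisions_le_sum (hV : 0 < V) :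
    (collisions V r₁ r₂ r₄ T S U J).card ≤
      ∑ b ∈ quads J, (shiftedPairs V r₁ r₂ T S U (quadDiff V r₄ b)).card := by
  rw [Finset.card_eq_sum_card_fiberwise (f := fun q => (q.1.2, q.2.2)) (t := quads J)
    (by
      intro q hq
      obtain ⟨h1, _⟩ := Finset.mem_filter.mp hq
      obtain ⟨h2, h3⟩ := Finset.mem_product.mp h1
      exact Finset.mem_product.mpr ⟨(Finset.mem_product.mp h2).2, (Finset.mem_product.mp h3).2⟩)]
  refine Finset.sum_le_sum fun b _ => ?_
  refine Finset.card_le_card_of_injOn (fun q => (q.1.1, q.2.1)) ?_ ?_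
  · intro q hq
    obtain ⟨h1, rfl⟩ := Finset.mem_filter.mp hq
    obtain ⟨h1, h4⟩ := Finset.mem_filter.mp h1
    obtain ⟨h2, h3⟩ := Finset.mem_product.mp h1
    refine Finset.mem_filter.mpr ⟨Finset.mem_product.mpr
      ⟨(Finset.mem_product.mp h2).1, (Finset.mem_product.mp h3).1⟩, ?_⟩
    have hV' : (4 * V : ℤ) ≠ 0 := by positivity
    apply mul_left_cancel₀ hV'
    unfold formValue at h4
    unfold quadDiff
    linear_combination h4
  · intro q hq q' hq' h
    have h1 := (Finset.mem_filter.mp hq).2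
    have h2 := (Finset.mem_filter.mp hq').2
    rw [← h2] at h1
    simp only [Prod.mk.injEq] at h h1
    exact Prod.ext (Prod.ext h.1 h1.1) (Prod.ext h.2 h1.2)

theorem card_collisions_le (hV : 0 < V)
    (h₁ : 1 ≤ r₁) (h₁' : r₁ ≤ 4 * V) (h₂ : 1 ≤ r₂) (h₂' : r₂ ≤ 4 * V) (h₄ : 1 ≤ r₄)
    (h₄' : r₄ ≤ 4 * V) (hK : 10 * V * J ^ 2 ≤ K) (hT : K < 2 * T) (hU : K + 4 ≤ 2 * U) :
    ((collisions V r₁ r₂ r₄ T S U J).card : ℝ) ≤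
      2 * (∑ b ∈ (quads J).filter (fun b => quadDiff V r₄ b ≠ 0),
        ((risingPairs V r₁ r₂ T S U (quadDiff V r₄ b)).card : ℝ)) +
      J ^ 4 * (S * (2 * K + 1)) +
      5 * J ^ 2 * (1 + Real.log J) ^ 2 *
        (4 * U ^ 2 * (S + U) / T * (1 + Real.log U) + S * U) := by
  have h0 : ((collisions V r₁ r₂ r₄ T S U J).card : ℝ) ≤
      ∑ b ∈ quads J, ((shiftedPairs V r₁ r₂ T S U (quadDiff V r₄ b)).card : ℝ) := by
    exact_mod_cast card_collisions_le_sum hV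
  refine h0.trans ?_
  rw [← Finset.sum_filter_add_sum_filter_not (quads J) (fun b => quadDiff V r₄ b ≠ 0)]
  refine add_le_add ?_ ?_
  -- Negating the shift permutes the quadruples of small parameters, so both signs of t - t'
  -- contribute equally.
  · have hswap : ∑ b ∈ (quads J).filter (fun b => quadDiff V r₄ b ≠ 0),
        ((risingPairs V r₁ r₂ T S U (-quadDiff V r₄ b)).card : ℝ) =
        ∑ b ∈ (quads J).filter (fun b => quadDiff V r₄ b ≠ 0),
        ((risingPairs V r₁ r₂ T S U (quadDiff V r₄ b)).card : ℝ) := by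
      have hm : ∀ b ∈ (quads J).filter (fun b => quadDiff V r₄ b ≠ 0),
          b.swap ∈ (quads J).filter (fun b => quadDiff V r₄ b ≠ 0) := by
        intro b hb
        obtain ⟨k1, k2⟩ := Finset.mem_filter.mp hb
        refine Finset.mem_filter.mpr ⟨swap_mem_quads k1, ?_⟩
        rw [quadDiff_swap]
        exact neg_ne_zero.mpr k2
      refine Finset.sum_nbij' Prod.swap Prod.swap hm hm (fun b _ => Prod.swap_swap b)
        (fun b _ => Prod.swap_swap b) fun b _ => ?_
      rw [quadDiff_swap]
    have hb : ∀ b ∈ (quads J).filter (fun b => quadDiff V r₄ b ≠ 0),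
        ((shiftedPairs V r₁ r₂ T S U (quadDiff V r₄ b)).card : ℝ) ≤
        (risingPairs V r₁ r₂ T S U (quadDiff V r₄ b)).card +
        (risingPairs V r₁ r₂ T S U (-quadDiff V r₄ b)).card + S * (2 * K + 1) := by
      intro b hb
      obtain ⟨k1, k2⟩ := Finset.mem_filter.mp hb
      have k3 := card_levelPairs_le (r₁ := r₁) (r₂ := r₂) (T := T) (S := S) (U := U) hV k2
        ((abs_quadDiff_le h₄ h₄' k1).trans (by exact_mod_cast hK : _ ≤ (K : ℤ)))
      exact_mod_cast (card_shiftedPairs_le V r₁ r₂ T S U _).trans (Nat.add_le_add_left k3 _)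
    refine (Finset.sum_le_sum hb).trans ?_
    rw [Finset.sum_add_distrib, Finset.sum_add_distrib, hswap, Finset.sum_const, nsmul_eq_mul,
      ← two_mul]
    have hc : (((quads J).filter (fun b => quadDiff V r₄ b ≠ 0)).card : ℝ) ≤ J ^ 4 := by
      exact_mod_cast (Finset.card_filter_le _ _).trans (card_quads J).le
    gcongr
  · have hr := card_risingPairs_zero_le (S := S) (U := U) hV h₁ h₁' h₂ h₂'
      (show 0 < T by omega) (by omega)
    have hl := card_levelPairs_zero_le (V := V) (r₁ := r₁) (T := T) (S := S) (U := U) h₂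
    have hl' : ((levelPairs V r₁ r₂ T S U 0).card : ℝ) ≤ S * U := by exact_mod_cast hl
    have hs : ((shiftedPairs V r₁ r₂ T S U 0).card : ℝ) ≤
        (risingPairs V r₁ r₂ T S U 0).card + (risingPairs V r₁ r₂ T S U 0).card +
          (levelPairs V r₁ r₂ T S U 0).card := by
      have := card_shiftedPairs_le V r₁ r₂ T S U 0
      rw [neg_zero] at this
      exact_mod_cast this
    have hs' : ((shiftedPairs V r₁ r₂ T S U 0).card : ℝ) ≤
        4 * U ^ 2 * (S + U) / T * (1 + Real.log U) + S * U := by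
      refine hs.trans ?_
      have : (4 * U ^ 2 * (S + U) / T * (1 + Real.log U) : ℝ) =
        2 * (2 * U ^ 2 * (S + U) / T * (1 + Real.log U)) := by ring
      linarith
    have hq := card_quads_quadDiff_zero_le (J := J) hV h₄
    simp only [not_not]
    calc _ = ∑ b ∈ (quads J).filter (fun b => quadDiff V r₄ b = 0),
          ((shiftedPairs V r₁ r₂ T S U 0).card : ℝ) :=
          Finset.sum_congr rfl fun b hb => by rw [(Finset.mem_filter.mp hb).2]
      _ = ((quads J).filter (fun b => quadDiff V r₄ b = 0)).card *
          ((shiftedPairs V r₁ r₂ T S U 0).card : ℝ) := by rw [Finset.sum_const, nsmul_eq_mul]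
      _ ≤ _ := by gcongr

end

/-! ### Divisor sums -/

/-- For completely multiplicative f, d(g)f(g) is the sum of f(a)f(b) over factorisations g = ab, so
the sum is part of an expanded square. -/
theorem sum_card_divisors_mul_le {f : ℕ → ℝ} (hf : ∀ n, 0 ≤ f n)
    (hm : ∀ a b, f (a * b) = f a * f b) {s t : Finset ℕ} (hs : ∀ g ∈ s, ∀ a, a ∣ g → a ∈ t) :
    ∑ g ∈ s, g.divisors.card * f g ≤ (∑ a ∈ t, f a) ^ 2 := by
  have h1 : ∀ g ∈ s, g.divisors.card * f g ≤
      ∑ p ∈ t ×ˢ t with p.1 * p.2 = g, f p.1 * f p.2 := by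
    intro g hg
    have e1 : g.divisors.card * f g = ∑ p ∈ g.divisorsAntidiagonal, f p.1 * f p.2 := by
      rw [Finset.sum_congr rfl (g := fun _ => f g), Finset.sum_const, nsmul_eq_mul,
        ← Nat.map_div_right_divisors, Finset.card_map]
      intro p hp
      rw [← hm, (Nat.mem_divisorsAntidiagonal.mp hp).1]
    rw [e1]
    refine Finset.sum_le_sum_of_subset_of_nonneg ?_ fun p _ _ => mul_nonneg (hf _) (hf _)
    intro p hp
    have h2 := (Nat.mem_divisorsAntidiagonal.mp hp).1
    simp only [Finset.mem_filter, Finset.mem_product]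
    exact ⟨⟨hs g hg _ (Dvd.intro _ h2), hs g hg _ (Dvd.intro_left _ h2)⟩, h2⟩
  refine (Finset.sum_le_sum h1).trans ?_
  have h2 : (∑ a ∈ t, f a) ^ 2 = ∑ p ∈ t ×ˢ t, f p.1 * f p.2 := by
    rw [sq, Finset.sum_mul_sum, Finset.sum_product]
  rw [h2]
  exact Finset.sum_fiberwise_le_sum_of_sum_fiber_nonneg fun g _ =>
    Finset.sum_nonneg fun p _ => mul_nonneg (hf _) (hf _)

theorem sum_card_divisors_div_le (K : ℕ) :
    ∑ g ∈ Finset.Icc 1 K, g.divisors.card * (g : ℝ)⁻¹ ≤ (1 + Real.log K) ^ 2 := by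
  refine (sum_card_divisors_mul_le (f := fun n => (n : ℝ)⁻¹) (t := Finset.Icc 1 K)
    (fun n => by positivity) (fun a b => by push_cast; exact mul_inv _ _) ?_).trans ?_
  · intro g hg a ha
    obtain ⟨h1, h2⟩ := Finset.mem_Icc.mp hg
    exact Finset.mem_Icc.mpr ⟨Nat.pos_of_dvd_of_pos ha h1, (Nat.le_of_dvd h1 ha).trans h2⟩
  · exact pow_le_pow_left₀ (Finset.sum_nonneg fun _ _ => by positivity) (sum_Icc_inv_le K) 2

theorem summable_card_divisors : Summable fun g : ℕ => g.divisors.card * ((g : ℝ) * √g)⁻¹ := by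
  have h0 : Summable fun n : ℕ => ((n : ℝ) * √n)⁻¹ := by
    refine (Real.summable_nat_rpow_inv (p := 3 / 2).mpr (by norm_num)).congr fun n => ?_
    congr 1
    rcases n.eq_zero_or_pos with rfl | hn
    · norm_num
    · rw [Real.sqrt_eq_rpow, ← Real.rpow_one_add' (by positivity) (by norm_num)]
      norm_num
  refine summable_of_sum_le (c := (∑' n : ℕ, ((n : ℝ) * √n)⁻¹) ^ 2) (fun g => by positivity) ?_
  intro s
  have h1 : ∑ g ∈ s, g.divisors.card * ((g : ℝ) * √g)⁻¹ =
      ∑ g ∈ s.erase 0, g.divisors.card * ((g : ℝ) * √g)⁻¹ := by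
    rw [Finset.sum_erase]; simp
  rw [h1]
  refine (sum_card_divisors_mul_le (f := fun n => ((n : ℝ) * √n)⁻¹)
    (t := (s.erase 0).biUnion Nat.divisors) (fun n => by positivity) ?_ ?_).trans ?_
  · intro a b
    push_cast
    rw [Real.sqrt_mul (Nat.cast_nonneg a), ← mul_inv]
    congr 1
    ring
  · intro g hg a ha
    exact Finset.mem_biUnion.mpr ⟨g, hg, Nat.mem_divisors.mpr ⟨ha, Finset.ne_of_mem_erase hg⟩⟩
  · exact pow_le_pow_left₀ (Finset.sum_nonneg fun _ _ => by positivity)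
      (h0.sum_le_tsum _ fun _ _ => by positivity) 2

theorem exists_sum_card_divisors_le {ε : ℝ} (hε : 0 < ε) : ∃ w : ℕ, 2 ≤ w ∧ ∀ K : ℕ,
    ∑ g ∈ Finset.Ioc w K, g.divisors.card * ((g : ℝ) * √g)⁻¹ ≤ ε := by
  obtain ⟨s, hs⟩ := summable_iff_vanishing_norm.mp summable_card_divisors ε hε
  refine ⟨max 2 (s.sup id), le_max_left _ _, fun K => ?_⟩
  refine (le_abs_self _).trans (hs _ ?_).le
  rw [Finset.disjoint_left]
  intro g hg hgs
  have h1 := (Finset.mem_Ioc.mp hg).1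
  have h2 : g ≤ s.sup id := Finset.le_sup (f := id) hgs
  exact absurd (h2.trans (le_max_right 2 _)) (not_le.mpr h1)

theorem sum_Ioc_card_divisors_le {V J w K : ℕ} (hV : 0 < V) {ε : ℝ}
    (hw : ∑ g ∈ Finset.Ioc w K, g.divisors.card * ((g : ℝ) * √g)⁻¹ ≤ ε) :
    ∑ g ∈ Finset.Ioc w K, g.divisors.card * (J / (2 * V * √g) + 1) / (g : ℝ) ≤
      J / (2 * V) * ε + (1 + Real.log K) ^ 2 := by
  have hV' : (0 : ℝ) < V := by exact_mod_cast hV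
  have h1 : ∀ g ∈ Finset.Ioc w K, g.divisors.card * (J / (2 * V * √g) + 1) / (g : ℝ) =
      J / (2 * V) * (g.divisors.card * ((g : ℝ) * √g)⁻¹) + g.divisors.card * (g : ℝ)⁻¹ := by
    intro g hg
    have : (0 : ℝ) < g := by
      exact_mod_cast (Nat.zero_le w).trans_lt (Finset.mem_Ioc.mp hg).1
    field_simp
  rw [Finset.sum_congr rfl h1, Finset.sum_add_distrib, ← Finset.mul_sum]
  refine add_le_add (mul_le_mul_of_nonneg_left hw (by positivity)) ?_
  refine le_trans (Finset.sum_le_sum_of_subset_of_nonneg ?_ fun _ _ _ => by positivity)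
    (sum_card_divisors_div_le K)
  intro g hg
  have := Finset.mem_Ioc.mp hg
  exact Finset.mem_Icc.mpr ⟨by omega, this.2⟩

/-! ### Asymptotics of the number of collisions -/

/-- The growth conditions on the range `J` of the parameters of the small variables. -/
structure AdmissibleRange (J : ℕ → ℕ) : Prop where
  tendsto : Tendsto J atTop atTop
  small : Tendsto (fun U : ℕ => (J U : ℝ) ^ 2 * (1 + Real.log U) / U) atTop (𝓝 0)
  large : Tendsto (fun U : ℕ => (1 + Real.log (J U)) ^ 2 * (1 + Real.log U) / (J U : ℝ) ^ 2)
    atTop (𝓝 0)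

theorem tendsto_sq_one_add_log_div {C : ℝ} (hC : 0 < C) :
    Tendsto (fun x : ℝ => (1 + Real.log (C * x ^ 2)) ^ 2 / x) atTop (𝓝 0) := by
  have h : (fun x : ℝ => 1 + Real.log (C * x ^ 2)) =o[atTop] fun x : ℝ => x ^ (1 / 2 : ℝ) := by
    have h1 : (fun _ : ℝ => 1 + Real.log C) =o[atTop] fun x : ℝ => x ^ (1 / 2 : ℝ) :=
      isLittleO_const_left.mpr (Or.inr (tendsto_norm_atTop_atTop.comp
        (tendsto_rpow_atTop (by norm_num))))
    have h2 := (isLittleO_log_rpow_atTop (show (0 : ℝ) < 1 / 2 by norm_num)).const_mul_left 2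
    refine (h1.add h2).congr' ?_ EventuallyEq.rfl
    filter_upwards [eventually_gt_atTop 0] with x hx
    rw [Real.log_mul hC.ne' (by positivity), Real.log_pow]
    push_cast
    ring
  have h2 := (h.mul h).tendsto_div_nhds_zero
  refine h2.congr' ?_
  filter_upwards [eventually_gt_atTop 0] with x hx
  rw [← Real.rpow_add hx, ← sq]
  norm_num

/-- In the condition on η, m/(2L) comes from the variation of t across the box, 2/m from the extra
point allowed on each line, and the term with ε from gcds above w. Everything else vanishes in the
limit; `large` disposes of the zero shifts. -/
theorem collisions_asymptotic {J : ℕ → ℕ} (hJ : AdmissibleRange J) {V w m L : ℕ} {ε η : ℝ}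
    (h2V : 2 ∣ V) (hV : 0 < V) (hw : ∀ p : ℕ, p.Prime → p ≤ w → p ∣ V)
    (hm : 0 < m) (hL : 0 < L)
    (htail : ∀ K : ℕ, ∑ g ∈ Finset.Ioc w K, g.divisors.card * ((g : ℝ) * √g)⁻¹ ≤ ε)
    (hη : (m : ℝ) / (2 * L) + 2 / m + 4 * (m + 1) / m * ε < η) :
    ∀ᶠ U : ℕ in atTop, ∀ r₁ r₂ r₄ : ℤ, 1 ≤ r₁ → r₁ ≤ 4 * V → 1 ≤ r₂ → r₂ ≤ 4 * V → 1 ≤ r₄ →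
      r₄ ≤ 4 * V → ((collisions V r₁ r₂ r₄ (L * U) (m * U) U (J U)).card : ℝ) ≤
        J U ^ 4 * U ^ 2 * (m / (2 * V * L) * (1 + η)) := by
  have hV' : (0 : ℝ) < V := by exact_mod_cast hV
  have hm' : (0 : ℝ) < m := by exact_mod_cast hm
  have hL' : (0 : ℝ) < L := by exact_mod_cast hL
  have hJr : Tendsto (fun U : ℕ => (J U : ℝ)) atTop atTop :=
    tendsto_natCast_atTop_atTop.comp hJ.tendsto
  have ta : Tendsto (fun U : ℕ => (U : ℝ)⁻¹) atTop (𝓝 0) :=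
    tendsto_inv_atTop_zero.comp tendsto_natCast_atTop_atTop
  have tb : Tendsto (fun U : ℕ => (J U : ℝ)⁻¹) atTop (𝓝 0) := tendsto_inv_atTop_zero.comp hJr
  have tc := hJ.small
  have tl : Tendsto (fun U : ℕ => (1 + Real.log U) / U) atTop (𝓝 0) := by
    have h1 : Tendsto (fun U : ℕ => Real.log U / U) atTop (𝓝 0) :=
      (Real.isLittleO_log_id_atTop.tendsto_div_nhds_zero).comp tendsto_natCast_atTop_atTop
    have h2 := ta.add h1
    rw [add_zero] at h2
    exact h2.congr fun U => by rw [add_div, one_div]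
  have tc' : Tendsto (fun U : ℕ => (J U : ℝ) ^ 2 / U) atTop (𝓝 0) := by
    refine squeeze_zero (fun U => by positivity) (fun U => ?_) tc
    gcongr
    exact le_mul_of_one_le_right (by positivity)
      (by linarith [Real.log_natCast_nonneg U])
  have tk : Tendsto (fun U : ℕ => (1 + Real.log ((10 * V * J U ^ 2 : ℕ) : ℝ)) ^ 2 / J U) atTop
      (𝓝 0) := by
    refine ((tendsto_sq_one_add_log_div (C := 10 * V) (by positivity)).comp hJr).congr fun U => ?_
    simp only [Function.comp_apply]
    push_cast
    rfl
  have tz := hJ.large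
  have tz' : Tendsto (fun U : ℕ => (1 + Real.log (J U)) ^ 2 / (J U : ℝ) ^ 2) atTop (𝓝 0) := by
    refine squeeze_zero (fun U => by positivity) (fun U => ?_) tz
    gcongr
    exact le_mul_of_one_le_right (by positivity)
      (by linarith [Real.log_natCast_nonneg U])
  -- The bounds `k1` to `k4` below, combined and divided by J⁴U².
  let F : ℕ → ℝ := fun U =>
    2 * (1 / (2 * V) + w * (J U : ℝ)⁻¹) *
      (m / L * (1 / 2 + 3 / 2 * (U : ℝ)⁻¹ + (m + 2 * (U : ℝ)⁻¹) * (1 + (U : ℝ)⁻¹) / (4 * L) +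
        (10 * V * ((J U : ℝ) ^ 2 * (1 + Real.log U) / U) * (U : ℝ)⁻¹ +
          L * ((1 + Real.log U) / U))) + (1 + (U : ℝ)⁻¹) / L) +
      4 * (m + 1) / L * (1 / (2 * V) * ε +
        (1 + Real.log ((10 * V * J U ^ 2 : ℕ) : ℝ)) ^ 2 / J U) +
      m * (20 * V * ((J U : ℝ) ^ 2 / U) + (U : ℝ)⁻¹) +
      5 * (4 * (m + 1) / L * ((1 + Real.log (J U)) ^ 2 * (1 + Real.log U) / (J U : ℝ) ^ 2) +
        m * ((1 + Real.log (J U)) ^ 2 / (J U : ℝ) ^ 2))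
  have hF : Tendsto F atTop (𝓝 (2 * (1 / (2 * V) + w * 0) *
      (m / L * (1 / 2 + 3 / 2 * 0 + (m + 2 * 0) * (1 + 0) / (4 * L) +
        (10 * V * 0 * 0 + L * 0)) + (1 + 0) / L) +
      4 * (m + 1) / L * (1 / (2 * V) * ε + 0) +
      m * (20 * V * 0 + 0) + 5 * (4 * (m + 1) / L * 0 + m * 0))) := by
    refine Tendsto.add (Tendsto.add (Tendsto.add (Tendsto.mul ?_ ?_) ?_) ?_) ?_
    · exact (tendsto_const_nhds.add (tb.const_mul _)).const_mul _
    · refine Tendsto.add (Tendsto.const_mul _ (Tendsto.add (Tendsto.add ?_ ?_) ?_)) ?_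
      · exact tendsto_const_nhds.add (ta.const_mul _)
      · exact ((tendsto_const_nhds.add (ta.const_mul _)).mul
          (tendsto_const_nhds.add ta)).div_const _
      · exact ((tc.const_mul _).mul ta).add (tl.const_mul _)
      · exact (tendsto_const_nhds.add ta).div_const _
    · exact (tendsto_const_nhds.add tk).const_mul _
    · exact ((tc'.const_mul _).add ta).const_mul _
    · exact ((tz.const_mul _).add (tz'.const_mul _)).const_mul _
  have hlim : 2 * (1 / (2 * V) + w * 0) *
      (m / L * (1 / 2 + 3 / 2 * 0 + (m + 2 * 0) * (1 + 0) / (4 * L) +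
        (10 * V * 0 * 0 + L * 0)) + (1 + 0) / L) +
      4 * (m + 1) / L * (1 / (2 * V) * ε + 0) +
      m * (20 * V * 0 + 0) + 5 * (4 * (m + 1) / L * 0 + m * 0) <
      (m / (2 * V * L) * (1 + η) : ℝ) := by
    calc _ = (m / (2 * V * L) * (1 + (m / (2 * L) + 2 / m + 4 * (m + 1) / m * ε)) : ℝ) := by
          field_simp; ring
      _ < _ := by gcongr
  filter_upwards [hF.eventually (eventually_le_nhds hlim), eventually_gt_atTop 0,
    hJ.tendsto.eventually_gt_atTop 0, tc'.eventually (eventually_le_nhds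
      (show (0 : ℝ) < (10 * (V : ℝ))⁻¹ by positivity)), eventually_ge_atTop 4] with U hFU hU hJU hsm hU4
  intro r₁ r₂ r₄ h₁ h₁' h₂ h₂' h₄ h₄'
  have hU' : (0 : ℝ) < U := by exact_mod_cast hU
  have hJ' : (0 : ℝ) < J U := by exact_mod_cast hJU
  have hKU : 10 * V * J U ^ 2 ≤ U := by
    have : (10 * V * (J U) ^ 2 : ℝ) ≤ U := by
      rw [div_le_iff₀ hU', inv_mul_eq_div, le_div_iff₀ (by positivity)] at hsm
      linarith
    exact_mod_cast this
  have hLU : U ≤ L * U := Nat.le_mul_of_pos_left U hL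
  have k1 := card_collisions_le (V := V) (T := L * U) (S := m * U) (U := U) (J := J U)
    (K := 10 * V * J U ^ 2) hV h₁ h₁' h₂ h₂' h₄ h₄' le_rfl (by omega) (by omega)
  have k2 := sum_card_risingPairs_le (V := V) (T := L * U) (S := m * U) (U := U) (J := J U)
    (K := 10 * V * J U ^ 2) h2V hV hw h₁ h₁' h₂ h₂' h₄ h₄' le_rfl (by omega) (by omega)
  have k3 := sum_diffRegion_le (T := L * U) (S := m * U) (U := U) (K := 10 * V * J U ^ 2)
    (by omega) (by omega)
  have k4 := sum_Ioc_card_divisors_le (J := J U) hV (htail (10 * V * J U ^ 2))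
  refine k1.trans (le_trans ?_ (mul_le_mul_of_nonneg_left hFU (by positivity)))
  have k5 := k2.trans (add_le_add (mul_le_mul_of_nonneg_left k3 (by positivity))
    (mul_le_mul_of_nonneg_left k4 (by positivity)))
  refine (add_le_add_left (add_le_add_left (mul_le_mul_of_nonneg_left k5 zero_le_two) _) _).trans
    (le_of_eq ?_)
  simp only [F]
  generalize Real.log ((10 * V * J U ^ 2 : ℕ) : ℝ) = lK
  generalize Real.log (U : ℝ) = lU
  generalize Real.log (J U : ℝ) = lJ
  push_cast
  field_simp
  ring

/-! ### Local solvability -/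

/-- Squarefreeness reduces solvability at odd primes to congruences modulo p, without lifting. -/
theorem exists_squarefree_dvd_of_le (w : ℕ) (hw : 2 ≤ w) :
    ∃ V : ℕ, 0 < V ∧ Squarefree V ∧ 2 ∣ V ∧ ∀ p : ℕ, p.Prime → p ≤ w → p ∣ V := by
  have h : ∀ p : ℕ, p.Prime → p ≤ w → p ∣ UniqueFactorizationMonoid.radical w.factorial := by
    intro p hp hpw
    rw [UniqueFactorizationMonoid.dvd_radical_iff_of_irreducible hp.prime.irreducible
      w.factorial_ne_zero]
    exact hp.dvd_factorial.mpr hpw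
  exact ⟨_, Nat.pos_of_ne_zero UniqueFactorizationMonoid.radical_ne_zero,
    UniqueFactorizationMonoid.squarefree_radical, h 2 Nat.prime_two hw, h⟩

theorem exists_dvd_sub_and_dvd_sub {a b : ℤ} (h : IsCoprime a b) (x y : ℤ) :
    ∃ z, a ∣ z - x ∧ b ∣ z - y := by
  obtain ⟨u, v, huv⟩ := h
  exact ⟨x + (y - x) * (u * a), ⟨(y - x) * u, by ring⟩, ⟨-(y - x) * v, by
    linear_combination (y - x) * huv⟩⟩

theorem sq_sub_sq_dvd {a x y : ℤ} (h : a ∣ x - y) : a ∣ x ^ 2 - y ^ 2 := by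
  rw [sq_sub_sq]; exact h.mul_left _

/-- Two squares represent every class modulo a prime; the Chinese remainder theorem glues the
primes. -/
theorem exists_dvd_sq_add_sq_sub {Q : ℕ} (hQ : Squarefree Q) (n : ℤ) :
    ∃ x y : ℤ, (Q : ℤ) ∣ x ^ 2 + y ^ 2 - n := by
  induction Q using Nat.recOnPosPrimePosCoprime with
  | prime_pow p k hp hk =>
    have hk1 : k = 1 := by
      rcases Nat.squarefree_pow_iff hp.ne_one hk.ne' |>.mp hQ with ⟨_, h⟩
      exact h
    have := Fact.mk hp
    obtain ⟨a, b, _, _, hab⟩ := Nat.sq_add_sq_zmodEq p n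
    refine ⟨a, b, ?_⟩
    rw [hk1, pow_one]
    exact hab.symm.dvd
  | zero => exact absurd hQ not_squarefree_zero
  | one => exact ⟨0, 0, by simp⟩
  | coprime a b _ _ hab iha ihb =>
    obtain ⟨_, h1, h2⟩ := Nat.squarefree_mul_iff.mp hQ
    obtain ⟨x, y, hxy⟩ := iha h1
    obtain ⟨x', y', hxy'⟩ := ihb h2
    have hc : IsCoprime (a : ℤ) b := Nat.isCoprime_iff_coprime.mpr hab
    obtain ⟨z, hz, hz'⟩ := exists_dvd_sub_and_dvd_sub hc x x'
    obtain ⟨t, ht, ht'⟩ := exists_dvd_sub_and_dvd_sub hc y y'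
    refine ⟨z, t, ?_⟩
    push_cast
    refine hc.mul_dvd ?_ ?_
    · rw [show z ^ 2 + t ^ 2 - n = (z ^ 2 - x ^ 2) + (t ^ 2 - y ^ 2) + (x ^ 2 + y ^ 2 - n) by ring]
      exact dvd_add (dvd_add (sq_sub_sq_dvd hz) (sq_sub_sq_dvd ht)) hxy
    · rw [show z ^ 2 + t ^ 2 - n = (z ^ 2 - x' ^ 2) + (t ^ 2 - y' ^ 2) + (x' ^ 2 + y' ^ 2 - n) by
        ring]
      exact dvd_add (dvd_add (sq_sub_sq_dvd hz') (sq_sub_sq_dvd ht')) hxy'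

/-- Three squares miss only the class 7 modulo 8, and n - 1 falls in it exactly when 8 divides n. -/
theorem exists_eight_dvd {n : ℤ} (hn : ¬ 8 ∣ n) :
    ∃ x y z : ℤ, 8 ∣ x ^ 2 + y ^ 2 + 1 + z ^ 2 - n := by
  have key : ∀ a : ZMod 8, a ≠ 0 → ∃ x y z : Fin 8,
      ((x : ℕ) : ZMod 8) ^ 2 + ((y : ℕ) : ZMod 8) ^ 2 + 1 + ((z : ℕ) : ZMod 8) ^ 2 - a = 0 := by
    decide
  have h0 : ((n : ℤ) : ZMod 8) ≠ 0 := by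
    rw [Ne, ZMod.intCast_zmod_eq_zero_iff_dvd]
    exact_mod_cast hn
  obtain ⟨x, y, z, h⟩ := key n h0
  refine ⟨(x : ℕ), (y : ℕ), (z : ℕ), ?_⟩
  have := (ZMod.intCast_zmod_eq_zero_iff_dvd
    (((x : ℕ) : ℤ) ^ 2 + ((y : ℕ) : ℤ) ^ 2 + 1 + ((z : ℕ) : ℤ) ^ 2 - n) 8).mp (by
      push_cast; exact h)
  exact_mod_cast this

theorem exists_dvd_sub_mem_Icc {q : ℤ} (hq : 0 < q) (x : ℤ) : ∃ r, q ∣ r - x ∧ 1 ≤ r ∧ r ≤ q := by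
  refine ⟨(x - 1) % q + 1, ?_, ?_, ?_⟩
  · refine ⟨-((x - 1) / q), ?_⟩
    have := Int.emod_add_mul_ediv (x - 1) q
    linarith
  · have := Int.emod_nonneg (x - 1) hq.ne'; omega
  · have := Int.emod_lt_of_pos (x - 1) hq; omega

theorem exists_residues {V : ℕ} (hV : 0 < V) (hs : Squarefree V) (h2 : 2 ∣ V) {n : ℤ}
    (hn : ¬ 8 ∣ n) : ∃ r₁ r₂ r₄ : ℤ, (1 ≤ r₁ ∧ r₁ ≤ 4 * V) ∧ (1 ≤ r₂ ∧ r₂ ≤ 4 * V) ∧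
      (1 ≤ r₄ ∧ r₄ ≤ 4 * V) ∧ (4 * V : ℤ) ∣ r₁ ^ 2 + r₂ ^ 2 + 1 + r₄ ^ 2 - n := by
  obtain ⟨Q, rfl⟩ := h2
  obtain ⟨hc, -, hQ⟩ := Nat.squarefree_mul_iff.mp hs
  have hc8 : IsCoprime (8 : ℤ) Q := by
    have : Nat.Coprime (2 ^ 3) Q := Nat.Coprime.pow_left 3 hc
    exact_mod_cast Nat.isCoprime_iff_coprime.mpr this
  obtain ⟨x, y, z, h8⟩ := exists_eight_dvd hn
  obtain ⟨x', y', hQd⟩ := exists_dvd_sq_add_sq_sub hQ (n - 1)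
  obtain ⟨s₁, a₁, b₁⟩ := exists_dvd_sub_and_dvd_sub hc8 x x'
  obtain ⟨s₂, a₂, b₂⟩ := exists_dvd_sub_and_dvd_sub hc8 y y'
  -- Modulo the odd part Q two squares already suffice, so the fourth variable is 0 there and
  -- matters only modulo 8.
  obtain ⟨s₄, a₄, b₄⟩ := exists_dvd_sub_and_dvd_sub hc8 z 0
  have hq : (0 : ℤ) < 4 * (2 * Q : ℕ) := by positivity
  obtain ⟨r₁, c₁, d₁⟩ := exists_dvd_sub_mem_Icc hq s₁
  obtain ⟨r₂, c₂, d₂⟩ := exists_dvd_sub_mem_Icc hq s₂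
  obtain ⟨r₄, c₄, d₄⟩ := exists_dvd_sub_mem_Icc hq s₄
  refine ⟨r₁, r₂, r₄, d₁, d₂, d₄, ?_⟩
  have hs : (4 * (2 * Q : ℕ) : ℤ) ∣ s₁ ^ 2 + s₂ ^ 2 + 1 + s₄ ^ 2 - n := by
    rw [show (4 * (2 * Q : ℕ) : ℤ) = 8 * Q by push_cast; ring]
    refine hc8.mul_dvd ?_ ?_
    · rw [show s₁ ^ 2 + s₂ ^ 2 + 1 + s₄ ^ 2 - n = (s₁ ^ 2 - x ^ 2) + (s₂ ^ 2 - y ^ 2) +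
        (s₄ ^ 2 - z ^ 2) + (x ^ 2 + y ^ 2 + 1 + z ^ 2 - n) by ring]
      exact dvd_add (dvd_add (dvd_add (sq_sub_sq_dvd a₁) (sq_sub_sq_dvd a₂)) (sq_sub_sq_dvd a₄)) h8
    · rw [show s₁ ^ 2 + s₂ ^ 2 + 1 + s₄ ^ 2 - n = (s₁ ^ 2 - x' ^ 2) + (s₂ ^ 2 - y' ^ 2) +
        (s₄ ^ 2 - 0 ^ 2) + (x' ^ 2 + y' ^ 2 - (n - 1)) by ring]
      exact dvd_add (dvd_add (dvd_add (sq_sub_sq_dvd b₁) (sq_sub_sq_dvd b₂)) (sq_sub_sq_dvd b₄)) hQd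
  rw [show r₁ ^ 2 + r₂ ^ 2 + 1 + r₄ ^ 2 - n = (r₁ ^ 2 - s₁ ^ 2) + (r₂ ^ 2 - s₂ ^ 2) +
    (r₄ ^ 2 - s₄ ^ 2) + (s₁ ^ 2 + s₂ ^ 2 + 1 + s₄ ^ 2 - n) by ring]
  exact dvd_add (dvd_add (dvd_add (sq_sub_sq_dvd c₁) (sq_sub_sq_dvd c₂)) (sq_sub_sq_dvd c₄)) hs

/-! ### Represented integers in a residue class -/

theorem card_sq_le_card_image_mul_card_collisions {α β : Type*} [DecidableEq β]
    (s : Finset α) (f : α → β) :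
    s.card ^ 2 ≤ (s.image f).card * ((s ×ˢ s).filter fun q => f q.1 = f q.2).card := by
  have h1 : s.card = ∑ y ∈ s.image f, (s.filter fun x => f x = y).card :=
    Finset.card_eq_sum_card_fiberwise fun x hx => Finset.mem_image_of_mem f hx
  have h2 : ((s ×ˢ s).filter fun q => f q.1 = f q.2).card =
      ∑ y ∈ s.image f, (s.filter fun x => f x = y).card ^ 2 := by
    rw [Finset.card_eq_sum_card_fiberwise (f := fun q => f q.1) (t := s.image f)
      (fun q hq => Finset.mem_image_of_mem f
        (Finset.mem_product.mp (Finset.mem_filter.mp hq).1).1)]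
    refine Finset.sum_congr rfl fun y _ => ?_
    rw [sq, ← Finset.card_product]
    congr 1
    ext q
    simp only [Finset.mem_filter, Finset.mem_product]
    constructor
    · rintro ⟨⟨⟨h1, h2⟩, h3⟩, h4⟩
      exact ⟨⟨h1, h4⟩, h2, h3 ▸ h4⟩
    · rintro ⟨⟨h1, h2⟩, h3, h4⟩
      exact ⟨⟨⟨h1, h3⟩, h2.trans h4.symm⟩, h2⟩
  rw [h1, h2]
  exact sq_sum_le_card_mul_sum_sq

/-- The integers represented by the form with parameters in the box. -/
noncomputable def formValues (V : ℕ) (r₁ r₂ r₄ : ℤ) (T S U J : ℕ) : Finset ℤ :=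
  (formBox T S U J).image (formValue V r₁ r₂ r₄)

theorem card_formBox (T S U J : ℕ) : (formBox T S U J).card = S * U * J ^ 2 := by
  rw [formBox, Finset.card_product, card_paramBox, card_paramBox]; ring

theorem mem_formBox {T S U J : ℕ} {p : (ℤ × ℤ) × (ℤ × ℤ)} : p ∈ formBox T S U J ↔
    (((T : ℤ) < p.1.1 ∧ p.1.1 ≤ T + S) ∧ (0 ≤ p.1.2 ∧ p.1.2 < U)) ∧
      ((0 ≤ p.2.1 ∧ p.2.1 < J) ∧ (0 ≤ p.2.2 ∧ p.2.2 < J)) := by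
  simp only [formBox, Finset.mem_product, mem_paramBox]
  omega

/-- An upper bound for the values of the form, divided by `4V²`. -/
def formTop (T S U J : ℕ) : ℕ := (T + S + 2) ^ 2 + (U + 2) ^ 2 + 2 * (J + 2) ^ 2

/-- The integers of a residue class in a range that contains all values of the form. -/
noncomputable def classRange (V : ℕ) (n : ℤ) (T S U J : ℕ) : Finset ℤ :=
  (Finset.Ioc ((4 * V ^ 2 * T ^ 2 : ℕ) : ℤ) ((4 * V ^ 2 * formTop T S U J : ℕ) : ℤ)).filter
    fun x => (4 * V : ℤ) ∣ x - n

theorem formValues_subset {V T S U J : ℕ} {r₁ r₂ r₄ n : ℤ} (hV : 0 < V)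
    (h₁ : 1 ≤ r₁ ∧ r₁ ≤ 4 * V) (h₂ : 1 ≤ r₂ ∧ r₂ ≤ 4 * V) (h₄ : 1 ≤ r₄ ∧ r₄ ≤ 4 * V)
    (hr : (4 * V : ℤ) ∣ r₁ ^ 2 + r₂ ^ 2 + 1 + r₄ ^ 2 - n) :
    formValues V r₁ r₂ r₄ T S U J ⊆ classRange V n T S U J := by
  intro x hx
  obtain ⟨p, hp, rfl⟩ := Finset.mem_image.mp hx
  obtain ⟨⟨⟨a1, a2⟩, a3, a4⟩, ⟨a5, a6⟩, a7, a8⟩ := mem_formBox.mp hp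
  have hV1 : (1 : ℤ) ≤ V := by exact_mod_cast hV
  have hT0 : (0 : ℤ) ≤ T := by positivity
  have hbd : ∀ (r x y : ℤ), 1 ≤ r ∧ r ≤ 4 * V → 0 ≤ x → x ≤ y →
      (r + 2 * V * x) ^ 2 ≤ 4 * V ^ 2 * (y + 2) ^ 2 := by
    intro r x y hr hx hxy
    have h1 : r + 2 * V * x ≤ 2 * V * (y + 2) := by
      have := mul_le_mul_of_nonneg_left hxy (show (0 : ℤ) ≤ 2 * V by positivity)
      linarith
    have h0 : 0 ≤ r + 2 * V * x := by
      have : 0 ≤ 2 * V * x := by positivity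
      linarith
    calc (r + 2 * V * x) ^ 2 ≤ (2 * V * (y + 2)) ^ 2 := pow_le_pow_left₀ h0 h1 2
      _ = _ := by ring
  refine Finset.mem_filter.mpr ⟨Finset.mem_Ioc.mpr ⟨?_, ?_⟩, ?_⟩
  · have h1 : 2 * V * T < r₁ + 2 * V * p.1.1 := by
      have := mul_le_mul_of_nonneg_left a1.le (show (0 : ℤ) ≤ 2 * V by positivity)
      linarith
    have h2 : (2 * V * T : ℤ) ^ 2 < (r₁ + 2 * V * p.1.1) ^ 2 :=
      pow_lt_pow_left₀ h1 (by positivity) (by norm_num)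
    unfold formValue
    push_cast
    nlinarith [sq_nonneg (r₂ + 2 * V * p.1.2), sq_nonneg (1 + 2 * V * p.2.1),
      sq_nonneg (r₄ + 2 * V * p.2.2)]
  · have b1 := hbd r₁ p.1.1 (T + S) h₁ (by omega) a2
    have b2 := hbd r₂ p.1.2 U h₂ a3 a4.le
    have b3 := hbd 1 p.2.1 J ⟨le_rfl, by omega⟩ a5 a6.le
    have b4 := hbd r₄ p.2.2 J h₄ a7 a8.le
    unfold formValue formTop
    push_cast
    linarith
  · unfold formValue
    rw [show (r₁ + 2 * V * p.1.1) ^ 2 + (r₂ + 2 * V * p.1.2) ^ 2 + (1 + 2 * V * p.2.1) ^ 2 +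
      (r₄ + 2 * V * p.2.2) ^ 2 - n = (r₁ ^ 2 + r₂ ^ 2 + 1 + r₄ ^ 2 - n) + 4 * V *
        ((r₁ * p.1.1 + V * p.1.1 ^ 2) + (r₂ * p.1.2 + V * p.1.2 ^ 2) + (p.2.1 + V * p.2.1 ^ 2) +
          (r₄ * p.2.2 + V * p.2.2 ^ 2)) by ring]
    exact dvd_add hr (dvd_mul_right _ _)

theorem card_classRange_le {V T S U J : ℕ} (hV : 0 < V) (n : ℤ) :
    ((classRange V n T S U J).card : ℝ) ≤ V * ((formTop T S U J : ℝ) - T ^ 2) + 1 := by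
  have hle : T ^ 2 ≤ formTop T S U J := by
    unfold formTop
    nlinarith [Nat.zero_le (U + 2), Nat.zero_le (J + 2), Nat.zero_le (S * T)]
  obtain ⟨D, hD⟩ := Nat.exists_eq_add_of_le hle
  have h := card_le_of_dvd_sub (s := classRange V n T S U J) (a := ((4 * V ^ 2 * T ^ 2 : ℕ) : ℤ))
    (S := 4 * V ^ 2 * D) (q := 4 * V) (by positivity)
    (by
      intro x hx
      have := Finset.mem_Ioc.mp (Finset.mem_filter.mp hx).1
      refine ⟨this.1, this.2.trans (le_of_eq ?_)⟩
      rw [hD]; push_cast; ring)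
    (by
      intro x hx y hy
      have := dvd_sub (Finset.mem_filter.mp hx).2 (Finset.mem_filter.mp hy).2
      rw [sub_sub_sub_cancel_right] at this
      exact_mod_cast this)
  refine h.trans (le_of_eq ?_)
  have hV' : (0 : ℝ) < V := by exact_mod_cast hV
  rw [hD]
  push_cast
  field_simp
  ring

/-- The integer `n` is a sum of four positive squares, two of which have roots at most `X`. -/
def HasSmallFourSquares (X : ℝ) (n : ℕ) : Prop :=
  ∃ x₁ x₂ x₃ x₄ : ℕ, 0 < x₁ ∧ 0 < x₂ ∧ 0 < x₃ ∧ 0 < x₄ ∧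
    n = x₁ ^ 2 + x₂ ^ 2 + x₃ ^ 2 + x₄ ^ 2 ∧ ((max x₃ x₄ : ℕ) : ℝ) ≤ X

theorem HasSmallFourSquares.mono {X Y : ℝ} (h : X ≤ Y) {n : ℕ} (hn : HasSmallFourSquares X n) :
    HasSmallFourSquares Y n := by
  obtain ⟨x₁, x₂, x₃, x₄, h₁, h₂, h₃, h₄, h₅, h₆⟩ := hn
  exact ⟨x₁, x₂, x₃, x₄, h₁, h₂, h₃, h₄, h₅, h₆.trans h⟩

theorem hasSmallFourSquares_of_mem_formValues {V T S U J n : ℕ} {r₁ r₂ r₄ : ℤ} (hV : 0 < V)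
    (h₁ : 1 ≤ r₁) (h₂ : 1 ≤ r₂) (h₄ : 1 ≤ r₄) (h₄' : r₄ ≤ 4 * V)
    (hn : (n : ℤ) ∈ formValues V r₁ r₂ r₄ T S U J) :
    HasSmallFourSquares (4 * V * J : ℕ) n := by
  obtain ⟨p, hp, hpn⟩ := Finset.mem_image.mp hn
  obtain ⟨⟨⟨a1, a2⟩, a3, a4⟩, ⟨a5, a6⟩, a7, a8⟩ := mem_formBox.mp hp
  have hV1 : (1 : ℤ) ≤ V := by exact_mod_cast hV
  have hT0 : (0 : ℤ) ≤ p.1.1 := by omega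
  have hpos : ∀ r x : ℤ, 1 ≤ r → 0 ≤ x → 0 < r + 2 * V * x := by
    intro r x hr hx
    have : 0 ≤ 2 * V * x := by positivity
    linarith
  have hsm : ∀ r x : ℤ, r ≤ 4 * V → 0 ≤ x → x < J → r + 2 * V * x ≤ 4 * V * J := by
    intro r x hr hx hxJ
    have h1 := mul_le_mul_of_nonneg_left (show x + 1 ≤ J by omega) (show (0 : ℤ) ≤ 2 * V by omega)
    have h2 := mul_le_mul_of_nonneg_left (show (1 : ℤ) ≤ J by omega) (show (0 : ℤ) ≤ 2 * V by omega)
    linarith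
  have p1 := hpos r₁ p.1.1 h₁ hT0
  have p2 := hpos r₂ p.1.2 h₂ a3
  have p3 := hpos 1 p.2.1 le_rfl a5
  have p4 := hpos r₄ p.2.2 h₄ a7
  have q3 := hsm 1 p.2.1 (by omega) a5 a6
  have q4 := hsm r₄ p.2.2 h₄' a7 a8
  unfold formValue at hpn
  obtain ⟨y₁, e₁⟩ := Int.eq_ofNat_of_zero_le p1.le
  obtain ⟨y₂, e₂⟩ := Int.eq_ofNat_of_zero_le p2.le
  obtain ⟨y₃, e₃⟩ := Int.eq_ofNat_of_zero_le p3.le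
  obtain ⟨y₄, e₄⟩ := Int.eq_ofNat_of_zero_le p4.le
  rw [e₁] at p1 hpn
  rw [e₂] at p2 hpn
  rw [e₃] at p3 q3 hpn
  rw [e₄] at p4 q4 hpn
  refine ⟨y₁, y₂, y₃, y₄, by exact_mod_cast p1, by exact_mod_cast p2, by exact_mod_cast p3,
    by exact_mod_cast p4, by exact_mod_cast hpn.symm, ?_⟩
  exact Nat.cast_le.mpr (max_le (by exact_mod_cast q3) (by exact_mod_cast q4))

/-- The range has length about 4V²((L + m)² + 1 - L²)U², and one integer in 4V is in the class; the
excess m² + 1 over 2Lm is what η absorbs. -/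
theorem eventually_card_classRange_le {J : ℕ → ℕ} (hJ : AdmissibleRange J) {V m L : ℕ} {η : ℝ}
    (hV : 0 < V) (hη : (m : ℝ) ^ 2 + 1 < 2 * L * m * η) :
    ∀ᶠ U : ℕ in atTop, ∀ n : ℤ,
      ((classRange V n (L * U) (m * U) U (J U)).card : ℝ) ≤ 2 * V * L * m * (1 + η) * U ^ 2 := by
  have hV' : (0 : ℝ) < V := by exact_mod_cast hV
  have ta : Tendsto (fun U : ℕ => (U : ℝ)⁻¹) atTop (𝓝 0) :=
    tendsto_inv_atTop_zero.comp tendsto_natCast_atTop_atTop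
  have tc : Tendsto (fun U : ℕ => (J U : ℝ) ^ 2 / U) atTop (𝓝 0) := by
    refine squeeze_zero (fun U => by positivity) (fun U => ?_) hJ.small
    gcongr
    exact le_mul_of_one_le_right (by positivity)
      (by linarith [Real.log_natCast_nonneg U])
  have tF : Tendsto (fun U : ℕ => V * ((L + m + 2 * (U : ℝ)⁻¹) ^ 2 + (1 + 2 * (U : ℝ)⁻¹) ^ 2 +
      (4 * ((J U : ℝ) ^ 2 / U * (U : ℝ)⁻¹) + 16 * ((U : ℝ)⁻¹ * (U : ℝ)⁻¹)) - L ^ 2) +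
      (U : ℝ)⁻¹ * (U : ℝ)⁻¹) atTop
      (𝓝 (V * ((L + m + 2 * 0) ^ 2 + (1 + 2 * 0) ^ 2 + (4 * (0 * 0) + 16 * (0 * 0)) - L ^ 2)
        + 0 * 0 : ℝ)) := by
    refine Tendsto.add (Tendsto.const_mul _ (Tendsto.sub_const (Tendsto.add (Tendsto.add ?_ ?_)
      (Tendsto.add ?_ ?_)) _)) (ta.mul ta)
    · exact (tendsto_const_nhds.add (ta.const_mul _)).pow 2
    · exact (tendsto_const_nhds.add (ta.const_mul _)).pow 2
    · exact (tc.mul ta).const_mul _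
    · exact (ta.mul ta).const_mul _
  have hlim : (V * ((L + m + 2 * 0) ^ 2 + (1 + 2 * 0) ^ 2 + (4 * (0 * 0) + 16 * (0 * 0)) - L ^ 2)
        + 0 * 0 : ℝ) < 2 * V * L * m * (1 + η) := by
    calc _ = (V * (2 * L * m + (m ^ 2 + 1)) : ℝ) := by ring
      _ < V * (2 * L * m + 2 * L * m * η) := by gcongr
      _ = _ := by ring
  filter_upwards [tF.eventually (eventually_le_nhds hlim), eventually_gt_atTop 0] with U hU hU0 n
  have hU' : (0 : ℝ) < U := by exact_mod_cast hU0
  refine (card_classRange_le hV n).trans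
    (le_trans ?_ (mul_le_mul_of_nonneg_right hU (by positivity : (0 : ℝ) ≤ (U : ℝ) ^ 2)))
  unfold formTop
  push_cast
  have e : (V * ((L + m + 2 * (U : ℝ)⁻¹) ^ 2 + (1 + 2 * (U : ℝ)⁻¹) ^ 2 +
      (4 * ((J U : ℝ) ^ 2 / U * (U : ℝ)⁻¹) + 16 * ((U : ℝ)⁻¹ * (U : ℝ)⁻¹)) - L ^ 2) +
      (U : ℝ)⁻¹ * (U : ℝ)⁻¹) * (U : ℝ) ^ 2 =
      V * (((L * U + m * U + 2) ^ 2 + (U + 2) ^ 2 + (4 * (J U : ℝ) ^ 2 + 16)) - (L * U) ^ 2)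
        + 1 := by
    field_simp
  rw [e]
  gcongr
  nlinarith [sq_nonneg ((J U : ℝ) - 2)]

theorem eventually_card_sdiff_le {J : ℕ → ℕ} (hJ : AdmissibleRange J) {V w m L : ℕ} {ε η : ℝ}
    (h2V : 2 ∣ V) (hV : 0 < V) (hw : ∀ p : ℕ, p.Prime → p ≤ w → p ∣ V)
    (hm : 0 < m) (hL : 0 < L) (hη0 : 0 < η)
    (htail : ∀ K : ℕ, ∑ g ∈ Finset.Ioc w K, g.divisors.card * ((g : ℝ) * √g)⁻¹ ≤ ε)
    (hη : (m : ℝ) / (2 * L) + 2 / m + 4 * (m + 1) / m * ε < η)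
    (hη' : (m : ℝ) ^ 2 + 1 < 2 * L * m * η) :
    ∀ᶠ U : ℕ in atTop, ∀ n r₁ r₂ r₄ : ℤ, (1 ≤ r₁ ∧ r₁ ≤ 4 * V) → (1 ≤ r₂ ∧ r₂ ≤ 4 * V) →
      (1 ≤ r₄ ∧ r₄ ≤ 4 * V) → (4 * V : ℤ) ∣ r₁ ^ 2 + r₂ ^ 2 + 1 + r₄ ^ 2 - n →
      ((classRange V n (L * U) (m * U) U (J U) \
        formValues V r₁ r₂ r₄ (L * U) (m * U) U (J U)).card : ℝ) ≤
        4 * V * L * m * η * U ^ 2 := by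
  have hV' : (0 : ℝ) < V := by exact_mod_cast hV
  have hm' : (0 : ℝ) < m := by exact_mod_cast hm
  have hL' : (0 : ℝ) < L := by exact_mod_cast hL
  filter_upwards [collisions_asymptotic hJ h2V hV hw hm hL htail hη,
    eventually_card_classRange_le hJ hV hη', eventually_gt_atTop 0,
    hJ.tendsto.eventually_gt_atTop 0] with U hE hR hU hJU n r₁ r₂ r₄ h₁ h₂ h₄ hr
  have hU' : (0 : ℝ) < U := by exact_mod_cast hU
  have hJ' : (0 : ℝ) < J U := by exact_mod_cast hJU
  have hE' := hE r₁ r₂ r₄ h₁.1 h₁.2 h₂.1 h₂.2 h₄.1 h₄.2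
  have hR' := hR n
  have hsub := formValues_subset (T := L * U) (S := m * U) (U := U) (J := J U) hV h₁ h₂ h₄ hr
  have hC := card_sq_le_card_image_mul_card_collisions (formBox (L * U) (m * U) U (J U))
    (formValue V r₁ r₂ r₄)
  rw [card_formBox] at hC
  change _ ≤ (formValues V r₁ r₂ r₄ (L * U) (m * U) U (J U)).card *
    (collisions V r₁ r₂ r₄ (L * U) (m * U) U (J U)).card at hC
  have hC' : ((m * U * U * (J U) ^ 2 : ℝ)) ^ 2 ≤
      (formValues V r₁ r₂ r₄ (L * U) (m * U) U (J U)).card *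
    ((collisions V r₁ r₂ r₄ (L * U) (m * U) U (J U)).card : ℝ) := by exact_mod_cast hC
  set I : ℝ := ((formValues V r₁ r₂ r₄ (L * U) (m * U) U (J U)).card : ℝ)
  have hI0 : 0 ≤ I := Nat.cast_nonneg _
  have h1 : 2 * V * L * m * U ^ 2 ≤ I * (1 + η) := by
    have h2 := hC'.trans (mul_le_mul_of_nonneg_left hE' hI0)
    have h3 : (0 : ℝ) < (J U) ^ 4 * U ^ 2 * m / (2 * V * L) := by positivity
    refine le_of_mul_le_mul_left ?_ h3
    calc ((J U) ^ 4 * U ^ 2 * m / (2 * V * L) : ℝ) * (2 * V * L * m * U ^ 2)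
        = (m * U * U * (J U) ^ 2 : ℝ) ^ 2 := by field_simp
      _ ≤ _ := h2
      _ = _ := by field_simp
  -- This uses (1 - η)(1 + η) ≤ 1.
  have h2 : 2 * V * L * m * U ^ 2 * (1 - η) ≤ I := by
    have h3 : (0 : ℝ) ≤ 2 * V * L * m * U ^ 2 := by positivity
    nlinarith [mul_nonneg h3 (sq_nonneg η)]
  rw [Finset.cast_card_sdiff hsub]
  change _ - I ≤ _
  linarith

/-- The constants are chosen in the order w, V, m, L, each in terms of η and the earlier ones.
Exceptions are split into the classes modulo 4V that contain one, and each such class is not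
divisible by 8, so it has admissible residues. -/
theorem exists_eventually_card_exceptions_le {J : ℕ → ℕ} (hJ : AdmissibleRange J) {θ : ℝ}
    (hθ : 0 < θ) : ∃ a b C : ℕ, 0 < a ∧ a < b ∧ ∀ᶠ U : ℕ in atTop, ∀ B : Finset ℕ,
      (∀ n ∈ B, a ^ 2 * U ^ 2 < n ∧ n ≤ b ^ 2 * U ^ 2 ∧ ¬ 8 ∣ n ∧
        ¬ HasSmallFourSquares (C * J U : ℕ) n) →
      (B.card : ℝ) ≤ θ * (b ^ 2 - a ^ 2) * U ^ 2 := by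
  set η := θ / 2 with hηdef
  have hη : 0 < η := by positivity
  obtain ⟨w, hw2, htail⟩ := exists_sum_card_divisors_le (show 0 < η / 32 by positivity)
  obtain ⟨V, hV, hVs, h2V, hw⟩ := exists_squarefree_dvd_of_le w hw2
  obtain ⟨m, hm⟩ := exists_nat_gt (8 / η)
  have hm' : (0 : ℝ) < m := lt_trans (by positivity) hm
  have hm1 : 0 < m := by exact_mod_cast hm'
  obtain ⟨L, hL⟩ := exists_nat_gt ((2 * m + 1) / η)
  have hL' : (0 : ℝ) < L := lt_trans (by positivity) hL
  have hL1 : 0 < L := by exact_mod_cast hL'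
  rw [div_lt_iff₀ hη] at hm hL
  have hm1' : (1 : ℝ) ≤ m := by exact_mod_cast hm1
  have c1 : (m : ℝ) / (2 * L) + 2 / m + 4 * (m + 1) / m * (η / 32) < η := by
    have d1 : (m : ℝ) / (2 * L) ≤ η / 4 := by
      rw [div_le_iff₀ (by positivity)]; linarith
    have d2 : 2 / (m : ℝ) ≤ η / 4 := by
      rw [div_le_iff₀ (by positivity)]; linarith
    have d3 : 4 * ((m : ℝ) + 1) / m * (η / 32) ≤ η / 4 := by
      have : 4 * ((m : ℝ) + 1) / m ≤ 8 := by rw [div_le_iff₀ hm']; linarith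
      calc _ ≤ 8 * (η / 32) := by gcongr
        _ = _ := by ring
    linarith
  have c2 : (m : ℝ) ^ 2 + 1 < 2 * L * m * η := by nlinarith
  have hV' : (0 : ℝ) < V := by exact_mod_cast hV
  refine ⟨2 * V * L, 2 * V * (L + m), 4 * V, by positivity, by
    exact Nat.mul_lt_mul_of_pos_left (by omega) (by positivity), ?_⟩
  filter_upwards [eventually_card_sdiff_le hJ h2V hV hw hm1 hL1 hη htail c1 c2] with U hU B hB
  have hfib : ∀ c ∈ Finset.range (4 * V), (((B.filter fun n => n % (4 * V) = c).card : ℕ) : ℝ) ≤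
      4 * V * L * m * η * U ^ 2 := by
    intro c _
    rcases (B.filter fun n => n % (4 * V) = c).eq_empty_or_nonempty with h0 | ⟨n₀, hn₀⟩
    · rw [h0, Finset.card_empty, Nat.cast_zero]; positivity
    obtain ⟨k1, k2⟩ := Finset.mem_filter.mp hn₀
    obtain ⟨_, _, k3, _⟩ := hB n₀ k1
    obtain ⟨r₁, r₂, r₄, h₁, h₂, h₄, hr⟩ := exists_residues hV hVs h2V
      (n := (n₀ : ℤ)) (by exact_mod_cast k3)
    refine le_trans ?_ (hU n₀ r₁ r₂ r₄ h₁ h₂ h₄ hr)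
    refine Nat.cast_le.mpr (Finset.card_le_card_of_injOn (fun n : ℕ => (n : ℤ)) ?_
      fun x _ y _ h => Nat.cast_injective h)
    intro n hn
    obtain ⟨l1, l2⟩ := Finset.mem_filter.mp hn
    obtain ⟨l3, l4, _, l5⟩ := hB n l1
    refine Finset.mem_sdiff.mpr ⟨Finset.mem_filter.mpr ⟨Finset.mem_Ioc.mpr ⟨?_, ?_⟩, ?_⟩, ?_⟩
    · refine Nat.cast_lt.mpr (lt_of_eq_of_lt ?_ l3)
      ring
    · refine Nat.cast_le.mpr (l4.trans ?_)
      unfold formTop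
      calc (2 * V * (L + m)) ^ 2 * U ^ 2 = 4 * V ^ 2 * (L * U + m * U) ^ 2 := by ring
        _ ≤ _ := by
          gcongr
          nlinarith [Nat.zero_le (L * U + m * U), Nat.zero_le ((U + 2) ^ 2),
            Nat.zero_le ((J U + 2) ^ 2)]
    · have : n ≡ n₀ [MOD 4 * V] := l2.trans k2.symm
      have := Nat.modEq_iff_dvd.mp this.symm
      push_cast at this
      exact this
    · intro hmem
      exact l5 (hasSmallFourSquares_of_mem_formValues hV h₁.1 h₂.1 h₄.1 h₄.2 hmem)
  rw [Finset.card_eq_sum_card_fiberwise (f := fun n => n % (4 * V)) (t := Finset.range (4 * V))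
    (fun n _ => Finset.mem_coe.mpr (Finset.mem_range.mpr (Nat.mod_lt _ (by positivity))))]
  push_cast
  refine (Finset.sum_le_sum hfib).trans ?_
  rw [Finset.sum_const, Finset.card_range, nsmul_eq_mul, hηdef]
  push_cast
  -- The 4V classes give at most 8θV²LmU², while the target is 4θV²(2Lm + m²)U²; the difference is
  -- this nonnegative term.
  have : 0 ≤ θ * V ^ 2 * m ^ 2 * (U : ℝ) ^ 2 := by positivity
  nlinarith

/-! ### Densities -/

theorem countUpTo_eq_card (E : ℕ → Prop) [DecidablePred E] (N : ℕ) :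
    countUpTo E N = ((Finset.Icc 1 N).filter E).card := by
  rw [countUpTo, ← Set.ncard_coe_finset]
  congr 1
  ext n
  simp [and_assoc]

/-- Induct from N to a²U², where b²U² is nearly N: the window (a²U², b²U²] has few exceptions, and
the leftover up to N is O(U). -/
theorem countUpTo_isLittleO {E : ℕ → Prop} (h : ∀ θ : ℝ, 0 < θ → ∃ a b : ℕ, 0 < a ∧ a < b ∧
    ∀ᶠ U : ℕ in atTop, ∀ B : Finset ℕ, (∀ n ∈ B, a ^ 2 * U ^ 2 < n ∧ n ≤ b ^ 2 * U ^ 2 ∧ E n) →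
      (B.card : ℝ) ≤ θ * (b ^ 2 - a ^ 2) * U ^ 2) :
    (fun N : ℕ => (countUpTo E N : ℝ)) =o[atTop] fun N : ℕ => (N : ℝ) := by
  classical
  rw [isLittleO_iff]
  intro c hc
  obtain ⟨a, b, ha, hab, hU⟩ := h (c / 4) (by positivity)
  have ha' : (0 : ℝ) < a := by exact_mod_cast ha
  have hab' : (a : ℝ) < b := by exact_mod_cast hab
  have hD : (0 : ℝ) < (b : ℝ) ^ 2 - a ^ 2 := by nlinarith
  -- The gap between consecutive values of b²U² is charged c/4, as is the window itself; together
  -- they fit the slope c/2 in `hmain`.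
  have hev : ∀ᶠ U : ℕ in atTop, (b : ℝ) ^ 2 * (2 * U + 1) ≤ c / 4 * (b ^ 2 - a ^ 2) * U ^ 2 := by
    have h1 : Tendsto (fun U : ℕ => (b : ℝ) ^ 2 * (2 * (U : ℝ)⁻¹ + (U : ℝ)⁻¹ * (U : ℝ)⁻¹)) atTop
        (𝓝 (b ^ 2 * (2 * 0 + 0 * 0) : ℝ)) := by
      have ta : Tendsto (fun U : ℕ => (U : ℝ)⁻¹) atTop (𝓝 0) :=
        tendsto_inv_atTop_zero.comp tendsto_natCast_atTop_atTop
      exact ((ta.const_mul _).add (ta.mul ta)).const_mul _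
    have h2 : (b : ℝ) ^ 2 * (2 * 0 + 0 * 0) < c / 4 * (b ^ 2 - a ^ 2) := by
      simp only [mul_zero, add_zero]; positivity
    filter_upwards [h1.eventually (eventually_le_nhds h2), eventually_gt_atTop 0] with U k1 k2
    have hU' : (0 : ℝ) < U := by exact_mod_cast k2
    calc (b : ℝ) ^ 2 * (2 * U + 1) = b ^ 2 * (2 * (U : ℝ)⁻¹ + (U : ℝ)⁻¹ * (U : ℝ)⁻¹) * U ^ 2 := by
          field_simp
      _ ≤ _ := by gcongr
  obtain ⟨U₀, hU₀⟩ := eventually_atTop.mp (hU.and hev)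
  set f : ℕ → ℕ := fun N => ((Finset.Icc 1 N).filter E).card with hf
  have hfN : ∀ N, f N ≤ N := fun N => (Finset.card_filter_le _ _).trans (by simp)
  have hmain : ∀ N : ℕ, (f N : ℝ) ≤ (b ^ 2 * (U₀ + 1) ^ 2 : ℕ) + c / 2 * N := by
    intro N
    induction N using Nat.strong_induction_on with
    | _ N ih =>
      set U := Nat.sqrt N / b with hUdef
      have hb0 : 0 < b := ha.trans hab
      have hlo : b ^ 2 * U ^ 2 ≤ N := by
        have h1 : b * U ≤ Nat.sqrt N := Nat.mul_div_le _ _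
        calc b ^ 2 * U ^ 2 = (b * U) ^ 2 := by ring
          _ ≤ (Nat.sqrt N) ^ 2 := Nat.pow_le_pow_left h1 2
          _ ≤ N := Nat.sqrt_le' N
      have hhi : N < b ^ 2 * (U + 1) ^ 2 := by
        have h1 : Nat.sqrt N + 1 ≤ b * (U + 1) := Nat.lt_mul_div_succ _ hb0
        calc N < (Nat.sqrt N + 1) ^ 2 := Nat.lt_succ_sqrt' N
          _ ≤ (b * (U + 1)) ^ 2 := Nat.pow_le_pow_left h1 2
          _ = _ := by ring
      rcases Nat.lt_or_ge U U₀ with hlt | hge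
      · have h1 : f N ≤ b ^ 2 * (U₀ + 1) ^ 2 := by
          refine (hfN N).trans (hhi.le.trans ?_)
          gcongr
        have h2 : (f N : ℝ) ≤ (b ^ 2 * (U₀ + 1) ^ 2 : ℕ) := by exact_mod_cast h1
        have : 0 ≤ c / 2 * N := by positivity
        linarith
      · rcases Nat.eq_zero_or_pos U with h0 | hUpos
        · have h1 : f N ≤ b ^ 2 * (U₀ + 1) ^ 2 := by
            refine (hfN N).trans (hhi.le.trans ?_)
            rw [h0]
            gcongr
            omega
          have h2 : (f N : ℝ) ≤ (b ^ 2 * (U₀ + 1) ^ 2 : ℕ) := by exact_mod_cast h1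
          have : 0 ≤ c / 2 * N := by positivity
          linarith
        obtain ⟨k1, k2⟩ := hU₀ U hge
        have hM : a ^ 2 * U ^ 2 < N := by
          refine lt_of_lt_of_le ?_ hlo
          have := Nat.pow_lt_pow_left hab (show 2 ≠ 0 by norm_num)
          exact Nat.mul_lt_mul_of_pos_right this (by positivity)
        have k3 := ih _ hM
        have k4 := k1 ((Finset.Ioc (a ^ 2 * U ^ 2) (b ^ 2 * U ^ 2)).filter E) (by
          intro n hn
          obtain ⟨l1, l2⟩ := Finset.mem_filter.mp hn
          obtain ⟨l3, l4⟩ := Finset.mem_Ioc.mp l1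
          exact ⟨l3, l4, l2⟩)
        have hsub : (Finset.Icc 1 N).filter E ⊆ (Finset.Icc 1 (a ^ 2 * U ^ 2)).filter E ∪
            (Finset.Ioc (a ^ 2 * U ^ 2) (b ^ 2 * U ^ 2)).filter E ∪
            Finset.Ioc (b ^ 2 * U ^ 2) N := by
          intro n hn
          simp only [Finset.mem_union, Finset.mem_filter, Finset.mem_Icc, Finset.mem_Ioc] at hn ⊢
          obtain ⟨⟨l1, l2⟩, l3⟩ := hn
          rcases Nat.lt_or_ge (a ^ 2 * U ^ 2) n with m1 | m1
          · rcases Nat.lt_or_ge (b ^ 2 * U ^ 2) n with m2 | m2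
            · exact Or.inr ⟨m2, l2⟩
            · exact Or.inl (Or.inr ⟨⟨m1, m2⟩, l3⟩)
          · exact Or.inl (Or.inl ⟨⟨l1, m1⟩, l3⟩)
        have k5 := (Finset.card_le_card hsub).trans ((Finset.card_union_le _ _).trans
          (Nat.add_le_add_right (Finset.card_union_le _ _) _))
        rw [Nat.card_Ioc] at k5
        have k6 : N - b ^ 2 * U ^ 2 ≤ b ^ 2 * (2 * U + 1) := by
          have : b ^ 2 * (U + 1) ^ 2 = b ^ 2 * U ^ 2 + b ^ 2 * (2 * U + 1) := by ring
          omega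
        have k7 : (f N : ℝ) ≤ f (a ^ 2 * U ^ 2) +
            ((Finset.Ioc (a ^ 2 * U ^ 2) (b ^ 2 * U ^ 2)).filter E).card +
            b ^ 2 * (2 * U + 1) := by
          exact_mod_cast k5.trans (Nat.add_le_add_left k6 _)
        have k8 : (b : ℝ) ^ 2 * U ^ 2 ≤ N := by exact_mod_cast hlo
        push_cast at k3 ⊢
        nlinarith
  filter_upwards [tendsto_natCast_atTop_atTop.eventually_ge_atTop
    ((b ^ 2 * (U₀ + 1) ^ 2 : ℕ) / (c / 2) : ℝ)] with N hN
  rw [div_le_iff₀ (by positivity)] at hN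
  rw [countUpTo_eq_card, Real.norm_of_nonneg (Nat.cast_nonneg _),
    Real.norm_of_nonneg (Nat.cast_nonneg _)]
  have := hmain N
  simp only [hf] at this
  linarith

/-! ### The choice of the range of the small variables -/

/-- With J about (log U)^{1/2}(log log U)^{5/4}, the ratio in `large` is O((log log U)^{-1/2}). An
exponent above 1 suffices there, and being below 3/2 leaves a power of log log U to absorb C, so J
does not depend on ε. -/
theorem exists_admissibleRange : ∃ J : ℕ → ℕ, AdmissibleRange J ∧ ∀ (C : ℕ) (ε : ℝ), 0 < ε →
    ∀ᶠ U : ℕ in atTop, ∀ n : ℕ, U ≤ n → ((C * J U : ℕ) : ℝ) ≤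
      (Real.log n) ^ ((1 : ℝ) / 2) * (Real.log (Real.log n)) ^ ((3 : ℝ) / 2 + ε) := by
  let G : ℕ → ℝ := fun U =>
    (Real.log U) ^ ((1 : ℝ) / 2) * (Real.log (Real.log U)) ^ ((5 : ℝ) / 4)
  have tx : Tendsto (fun U : ℕ => Real.log U) atTop atTop :=
    Real.tendsto_log_atTop.comp tendsto_natCast_atTop_atTop
  have ty : Tendsto (fun U : ℕ => Real.log (Real.log U)) atTop atTop :=
    Real.tendsto_log_atTop.comp tx
  have hG1 : ∀ᶠ U : ℕ in atTop, (Real.log U) ^ ((1 : ℝ) / 2) ≤ G U := by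
    filter_upwards [tx.eventually_gt_atTop 0, ty.eventually_ge_atTop 1] with U hx hy
    exact le_mul_of_one_le_right (by positivity) (Real.one_le_rpow hy (by norm_num))
  have tG : Tendsto G atTop atTop :=
    tendsto_atTop_mono' _ hG1 ((tendsto_rpow_atTop (by norm_num)).comp tx)
  have hlow : ∀ U, G U ≤ (⌈G U⌉₊ : ℝ) := fun U => Nat.le_ceil _
  have hhigh : ∀ᶠ U : ℕ in atTop, (⌈G U⌉₊ : ℝ) ≤ 2 * G U := by
    filter_upwards [tG.eventually_ge_atTop 1] with U h1
    have := Nat.ceil_lt_add_one (show 0 ≤ G U by linarith)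
    linarith
  -- This crude bound suffices for `small`, and gives log J ≤ log log U for `large`.
  have hlog : ∀ᶠ U : ℕ in atTop, (⌈G U⌉₊ : ℝ) ≤ Real.log U := by
    have h1 : ∀ᶠ x : ℝ in atTop, ‖(Real.log x) ^ ((5 : ℝ) / 4)‖ ≤ 1 / 2 * ‖x ^ ((1 : ℝ) / 2)‖ :=
      (isLittleO_log_rpow_rpow_atTop (s := 1 / 2) ((5 : ℝ) / 4) (by norm_num)).def (by norm_num)
    filter_upwards [hhigh, tx.eventually h1, tx.eventually_gt_atTop 0,
      ty.eventually_ge_atTop 0] with U k1 k2 k3 k4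
    rw [Real.norm_of_nonneg (by positivity), Real.norm_of_nonneg (by positivity)] at k2
    calc (⌈G U⌉₊ : ℝ) ≤ 2 * ((Real.log U) ^ ((1 : ℝ) / 2) *
          (1 / 2 * (Real.log U) ^ ((1 : ℝ) / 2))) := by
          refine k1.trans (mul_le_mul_of_nonneg_left ?_ zero_le_two)
          exact mul_le_mul_of_nonneg_left k2 (by positivity)
      _ = (Real.log U) ^ ((1 : ℝ) / 2) * (Real.log U) ^ ((1 : ℝ) / 2) := by ring
      _ = Real.log U := by rw [← Real.rpow_add k3]; norm_num
  refine ⟨fun U => ⌈G U⌉₊, ⟨?_, ?_, ?_⟩, ?_⟩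
  · exact tendsto_nat_ceil_atTop.comp tG
  · have h1 : Tendsto (fun U : ℕ => 2 * (Real.log U ^ 3 * Real.exp (-Real.log U))) atTop
        (𝓝 (2 * 0)) :=
      ((Real.tendsto_pow_mul_exp_neg_atTop_nhds_zero 3).comp tx).const_mul 2
    rw [mul_zero] at h1
    refine squeeze_zero' (Eventually.of_forall fun U => ?_) ?_ h1
    · have := Real.log_natCast_nonneg U
      positivity
    · filter_upwards [hlog, tx.eventually_ge_atTop 1, eventually_gt_atTop 0] with U k1 k2 k3
      have hU : (0 : ℝ) < U := by exact_mod_cast k3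
      rw [Real.exp_neg, Real.exp_log hU]
      calc (⌈G U⌉₊ : ℝ) ^ 2 * (1 + Real.log U) / U ≤ Real.log U ^ 2 * (2 * Real.log U) / U := by
            gcongr
            linarith
        _ = 2 * (Real.log U ^ 3 * (U : ℝ)⁻¹) := by ring
  · have h1 : Tendsto (fun U : ℕ => 8 * (Real.log (Real.log U)) ^ (-((1 : ℝ) / 2))) atTop
        (𝓝 (8 * 0)) :=
      ((tendsto_rpow_neg_atTop (by norm_num)).comp ty).const_mul 8
    rw [mul_zero] at h1
    refine squeeze_zero' (Eventually.of_forall fun U => ?_) ?_ h1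
    · have := Real.log_natCast_nonneg U
      positivity
    · filter_upwards [hlog, tx.eventually_ge_atTop 1, ty.eventually_ge_atTop 1,
        tG.eventually_ge_atTop 1] with U k1 k2 k3 k4
      have hG0 : (0 : ℝ) < ⌈G U⌉₊ := lt_of_lt_of_le (by linarith) (hlow U)
      have l1 : Real.log (⌈G U⌉₊ : ℝ) ≤ Real.log (Real.log U) := Real.log_le_log hG0 k1
      have l0 : 0 ≤ Real.log (⌈G U⌉₊ : ℝ) := Real.log_natCast_nonneg _
      set x := Real.log U
      set y := Real.log x
      have hx0 : 0 < x := by linarith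
      have hy0 : 0 < y := by linarith
      have hGsq : G U ^ 2 = x * y ^ ((5 : ℝ) / 2) := by
        simp only [G]
        rw [mul_pow, ← Real.rpow_natCast, ← Real.rpow_mul hx0.le, ← Real.rpow_natCast (y ^ _),
          ← Real.rpow_mul hy0.le]
        norm_num
      have hyy : y ^ ((5 : ℝ) / 2) * y ^ (-((1 : ℝ) / 2)) = y ^ 2 := by
        rw [← Real.rpow_add hy0, ← Real.rpow_natCast]
        norm_num
      calc (1 + Real.log (⌈G U⌉₊ : ℝ)) ^ 2 * (1 + x) / (⌈G U⌉₊ : ℝ) ^ 2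
          ≤ (2 * y) ^ 2 * (2 * x) / G U ^ 2 := by
            gcongr
            · linarith
            · linarith
            · exact hlow U
        _ = 8 * y ^ (-((1 : ℝ) / 2)) := by
            rw [hGsq, div_eq_iff (by positivity)]
            linear_combination -(8 * x) * hyy
  · intro C ε hε
    have hC : ∀ᶠ U : ℕ in atTop,
        2 * (C : ℝ) ≤ (Real.log (Real.log U)) ^ ((1 : ℝ) / 4 + ε) :=
      ((tendsto_rpow_atTop (by positivity)).comp ty).eventually_ge_atTop _
    filter_upwards [hhigh, hC, tx.eventually_ge_atTop 1, ty.eventually_ge_atTop 1,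
      eventually_gt_atTop 0] with U k1 k2 k3 k4 k5 n hn
    have hU0 : (0 : ℝ) < U := by exact_mod_cast k5
    have hnU : (U : ℝ) ≤ n := by exact_mod_cast hn
    have hl1 : Real.log U ≤ Real.log n := Real.log_le_log hU0 hnU
    have hl2 : Real.log (Real.log U) ≤ Real.log (Real.log n) :=
      Real.log_le_log (by linarith) hl1
    have hy0 : 0 < Real.log (Real.log U) := by linarith
    push_cast
    calc (C : ℝ) * ⌈G U⌉₊ ≤ C * (2 * G U) := by gcongr
      _ = (2 * C) * ((Real.log U) ^ ((1 : ℝ) / 2) *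
          (Real.log (Real.log U)) ^ ((5 : ℝ) / 4)) := by simp only [G]; ring
      _ ≤ (Real.log (Real.log U)) ^ ((1 : ℝ) / 4 + ε) * ((Real.log U) ^ ((1 : ℝ) / 2) *
          (Real.log (Real.log U)) ^ ((5 : ℝ) / 4)) := by gcongr
      _ = (Real.log U) ^ ((1 : ℝ) / 2) * (Real.log (Real.log U)) ^ ((3 : ℝ) / 2 + ε) := by
          rw [mul_left_comm, ← Real.rpow_add hy0]
          congr 2
          ring
      _ ≤ _ := by gcongr

theorem theorem1p5 (ε : ℝ) (hε : 0 < ε) :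
    ForAlmostAllNatWith (fun n : ℕ => ¬ 8 ∣ n) (fun n : ℕ =>
      ∃ x₁ x₂ x₃ x₄ : ℕ, 0 < x₁ ∧ 0 < x₂ ∧ 0 < x₃ ∧ 0 < x₄ ∧
        n = x₁ ^ 2 + x₂ ^ 2 + x₃ ^ 2 + x₄ ^ 2 ∧
        ((max x₃ x₄ : ℕ) : ℝ) ≤
          (Real.log (n : ℝ)) ^ ((1 : ℝ) / 2) *
            (Real.log (Real.log (n : ℝ))) ^ ((3 : ℝ) / 2 + ε)) := by
  obtain ⟨J, hJ, hbound⟩ := exists_admissibleRange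
  refine countUpTo_isLittleO fun θ hθ => ?_
  obtain ⟨a, b, C, ha, hab, h⟩ := exists_eventually_card_exceptions_le hJ hθ
  refine ⟨a, b, ha, hab, ?_⟩
  filter_upwards [h, hbound C ε hε] with U hU hC B hB
  refine hU B fun n hn => ?_
  obtain ⟨h1, h2, h3, h4⟩ := hB n hn
  refine ⟨h1, h2, h3, fun h5 => h4 (h5.mono (hC n ?_))⟩
  -- The size bound was set in terms of U; elements of the window exceed U, so it carries over to
  -- log n.
  have : U ≤ a ^ 2 * U ^ 2 := by
    calc U ≤ U ^ 2 := Nat.le_self_pow two_ne_zero U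
      _ ≤ a ^ 2 * U ^ 2 := Nat.le_mul_of_pos_left _ (by positivity)
  omega
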